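/- Let $G$ be a locally compact (Hausdorff) group with a fixed left Haar measure $dt$ and modular function $\gamma$. Let $A$ be a locally $C^*$-algebra, i.e. a complete Hausdorff complex topological $*$-algebra whose topology is determined by a family of $C^*$-seminorms, and let $\alpha$ be a continuous action of $G$ on $A$: a homomorphism $t\mapsto\alpha_t$ into the topological $*$-automorphisms of $A$ with $(t,a)\mapsto\alpha_t(a)$ jointly continuous. Assume that $\alpha$ is an inverse limit action, i.e. $A$ can be written as an inverse limit $\varprojlim_{\delta\in\Delta}A_\delta$ of $C^*$-algebras over a directed set, in such a way that there are actions $\alpha^{(\delta)}$ of $G$ on $A_\delta$ with $\alpha_t=\varprojlim_\delta\alpha^{(\delta)}_t$ for all $t\in G$. Let $C_c(G,A)$ be the $*$-algebra of continuous compactly supported functions $G\to A$ with $$(f\times h)(s)=\int_G f(t)\,\alpha_t\big(h(t^{-1}s)\big)\,dt,\qquad f^{\sharp}(t)=\gamma(t)^{-1}\alpha_t\big(f(t^{-1})^*\big),$$ and let $L^1(G,A,\alpha)$ be its Hausdorff completion with respect to the seminorms $N_p(f)=\int_G p(f(s))\,ds$, where $p$ runs through the $G$-invariant continuous $C^*$-seminorms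 on $A$. A $*$-representation of a topological $*$-algebra $B$ on a Hilbert space $H$ is a continuous $*$-homomorphism $\Phi$ from $B$ into the bounded operators on $H$ (with the norm topology); it is non-degenerate if the vectors $\Phi(b)\xi$ ($b\in B$, $\xi\in H$) span a dense subspace of $H$. A covariant representation of $(G,A,\alpha)$ is a triple $(\varphi,u,H)$ where $(\varphi,H)$ is a $*$-representation of $A$ and $(u,H)$ is a strongly continuous unitary representation of $G$ such that $\varphi(\alpha_t(a))=u_t\varphi(a)u_t^*$ for all $t\in G$, $a\in A$; it is non-degenerate if $(\varphi,H)$ is. Proposition 3.13. Let $H$ be a complex Hilbert space. For every non-degenerate covariant representation $(\varphi,u,H)$ of $(G,A,\alpha)$ there is a non-degenerate $*$-representation $(\varphi\times u,H)$ of $L^1(G,A,\alpha)$ with $$(\varphi\times u)(f)\,\xi=\int_G\varphi(f(t))\,u_t\xi\,dt\qquad(f\in C_c(G,A),\ \xi\in H),$$ and the map $(\varphi,u,H)\mapsto(\varphi\times u,H)$ is a bijection from the non-degenerate covariant representations of $(G,A,\alpha)$ on $H$ onto the non-degenerate $*$-representations of $L^1(G,A,\alpha)$ on $H$. -/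

import Mathlib

universe v w

noncomputable section

open MeasureTheory Filter Topology UniformSpace

set_option linter.unusedSectionVars false

/-! ### Integrals of functions with values in a locally convex space -/

section WeakIntegral

variable {X : Type*} [MeasurableSpace X] {E : Type*} [AddCommGroup E] [Module ℂ E]

/-- `a` is the (weak) integral of the vector valued function `f`:
`ℓ a = ∫ ℓ (f x) dμ(x)` for every continuous linear functional `ℓ`. -/
def IsWeakIntegral [TopologicalSpace E] (μ : Measure X) (f : X → E) (a : E) : Prop :=
  ∀ ℓ : StrongDual ℂ E, ℓ a = ∫ x, ℓ (f x) ∂μ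

open scoped Classical in
/-- The (weak) integral `∫ f dμ`. For continuous compactly supported `f` with values in a complete
locally convex space it exists, see `isWeakIntegral_weakIntegral`, and it is unique, see
`IsWeakIntegral.unique`. -/
def weakIntegral [TopologicalSpace E] (μ : Measure X) (f : X → E) : E :=
  if h : ∃ a, IsWeakIntegral μ f a then h.choose else 0

theorem Seminorm.exists_norming (p : Seminorm ℂ E) (x : E) :
    ∃ ℓ : E →ₗ[ℂ] ℂ, (∀ y, ‖ℓ y‖ ≤ p y) ∧ ℓ x = (p x : ℂ) := by
  let : SeminormedAddCommGroup E := p.toSeminormedAddCommGroup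
  let : NormedSpace ℂ E := { norm_smul_le := fun a b => (map_smul_eq_mul p a b).le }
  obtain ⟨g, hg, hx⟩ := exists_dual_vector'' ℂ x
  refine ⟨g.toLinearMap, fun y => ?_, hx⟩
  exact (g.le_opNorm y).trans (by
    calc ‖g‖ * ‖y‖ ≤ 1 * ‖y‖ := by gcongr
      _ = p y := one_mul _)

theorem exists_approx_integral_of_seminormed {E : Type*} [SeminormedAddCommGroup E]
    [NormedSpace ℂ E] [TopologicalSpace X] [OpensMeasurableSpace X]
    (μ : Measure X) [IsFiniteMeasureOnCompacts μ] {f : X → E} (hc : Continuous f)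
    (hs : HasCompactSupport f) {ε : ℝ} (hε : 0 < ε) :
    ∃ b : E, ∀ ℓ : E →ₗ[ℂ] ℂ, (∀ y, ‖ℓ y‖ ≤ 1 * ‖y‖) → ‖ℓ b - ∫ x, ℓ (f x) ∂μ‖ ≤ ε := by
  have hg : Continuous fun x => (f x : Completion E) := (Completion.continuous_coe E).comp hc
  have hs' : HasCompactSupport fun x => (f x : Completion E) := 
    hs.comp_left (g := fun y : E => (y : Completion E)) Completion.coe_zero
  have hint : Integrable (fun x => (f x : Completion E)) μ := hg.integrable_of_hasCompactSupport hs'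
  obtain ⟨b, hb⟩ := (Completion.denseRange_coe (α := E)).exists_dist_lt
    (∫ x, (f x : Completion E) ∂μ) hε
  refine ⟨b, fun ℓ hℓ => ?_⟩
  let L : E →L[ℂ] ℂ := ℓ.mkContinuous 1 hℓ
  let ι : E →L[ℂ] Completion E := Completion.toComplL
  have hd : DenseRange ι := Completion.denseRange_coe
  have hi : IsUniformInducing ι := Completion.isUniformInducing_coe E
  let L' : Completion E →L[ℂ] ℂ := L.extend ι
  have hL' : ∀ y : E, L' (y : Completion E) = ℓ y := fun y => L.extend_eq hd hi y
  have hn : ∀ z, ‖L' z‖ ≤ ‖z‖ := fun z => by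
    induction z using Completion.induction_on with
    | hp => exact isClosed_le (by fun_prop) (by fun_prop)
    | ih y => rw [hL', Completion.norm_coe]; simpa using hℓ y
  have h1 : ∫ x, ℓ (f x) ∂μ = L' (∫ x, (f x : Completion E) ∂μ) := by
    rw [← ContinuousLinearMap.integral_comp_comm L' hint]
    simp only [hL']
  rw [h1, ← hL' b, ← map_sub]
  refine (hn _).trans ?_
  rw [← dist_eq_norm, dist_comm]
  exact hb.le

theorem Seminorm.exists_approx_integral [TopologicalSpace X] [OpensMeasurableSpace X]
    (μ : Measure X) [IsFiniteMeasureOnCompacts μ] (p : Seminorm ℂ E) {f : X → E}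
    (hf : ∀ x, Tendsto (fun y => p (f y - f x)) (𝓝 x) (𝓝 0)) (hK : HasCompactSupport f)
    {ε : ℝ} (hε : 0 < ε) :
    ∃ b : E, ∀ ℓ : E →ₗ[ℂ] ℂ, (∀ y, ‖ℓ y‖ ≤ p y) → ‖ℓ b - ∫ x, ℓ (f x) ∂μ‖ ≤ ε := by
  let _ : SeminormedAddCommGroup E := p.toSeminormedAddCommGroup
  let _ : NormedSpace ℂ E := { norm_smul_le := fun a b => (map_smul_eq_mul p a b).le }
  have hc : Continuous f := by
    rw [continuous_iff_continuousAt]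
    intro x
    exact tendsto_iff_norm_sub_tendsto_zero.2 (hf x)
  obtain ⟨b, hb⟩ := exists_approx_integral_of_seminormed μ hc hK hε
  exact ⟨b, fun ℓ hℓ => hb ℓ fun y => by rw [one_mul]; exact hℓ y⟩

variable [UniformSpace E] [IsUniformAddGroup E] [PolynormableSpace ℂ E]

theorem continuous_of_le_seminorm {p : Seminorm ℂ E} (hp : Continuous p) {ℓ : E →ₗ[ℂ] ℂ}
    (h : ∀ y, ‖ℓ y‖ ≤ p y) : Continuous ℓ := by
  refine continuous_of_continuousAt_zero ℓ ?_
  have h0 : Tendsto p (𝓝 0) (𝓝 0) := hp.tendsto' 0 0 (map_zero p)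
  rw [ContinuousAt, map_zero]
  exact squeeze_zero_norm h h0

theorem eq_zero_of_forall_seminorm [T2Space E] {x : E}
    (h : ∀ p : Seminorm ℂ E, Continuous p → p x = 0) : x = 0 := by
  by_contra hx
  obtain ⟨p, hp⟩ := (PolynormableSpace.withSeminorms ℂ E).separating_of_T1 x hx
  exact hp (h p.1 p.2)

theorem IsWeakIntegral.unique [T2Space E] {μ : Measure X} {f : X → E} {a b : E}
    (ha : IsWeakIntegral μ f a) (hb : IsWeakIntegral μ f b) : a = b := by
  rw [← sub_eq_zero]
  refine eq_zero_of_forall_seminorm fun p hp => ?_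
  obtain ⟨ℓ, h1, h2⟩ := p.exists_norming (a - b)
  have h3 := ha ⟨ℓ, continuous_of_le_seminorm hp h1⟩
  have h4 := hb ⟨ℓ, continuous_of_le_seminorm hp h1⟩
  have h5 : ℓ (a - b) = 0 := by
    rw [map_sub, sub_eq_zero]; exact h3.trans h4.symm
  rw [h5] at h2
  exact_mod_cast h2.symm

theorem exists_isWeakIntegral [CompleteSpace E] [TopologicalSpace X] [OpensMeasurableSpace X]
    (μ : Measure X) [IsFiniteMeasureOnCompacts μ] {f : X → E} (hf : Continuous f)
    (hfs : HasCompactSupport f) : ∃ a, IsWeakIntegral μ f a := by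
  let S : Type _ := {p : Seminorm ℂ E // Continuous p} × {ε : ℝ // 0 < ε}
  let B : S → Set E := fun s => {b | ∀ ℓ : E →ₗ[ℂ] ℂ, (∀ y, ‖ℓ y‖ ≤ s.1.1 y) →
    ‖ℓ b - ∫ x, ℓ (f x) ∂μ‖ ≤ s.2.1}
  have hne : ∀ s, (B s).Nonempty := fun s => by
    refine s.1.1.exists_approx_integral μ (fun x => ?_) hfs s.2.2
    have : Continuous fun y => s.1.1 (f y - f x) := s.1.2.comp (hf.sub continuous_const)
    exact this.tendsto' x 0 (by simp)
  have hdir : Directed (· ≥ ·) B := by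
    rintro ⟨p, ε⟩ ⟨q, δ⟩
    refine ⟨⟨⟨p.1 ⊔ q.1, ?_⟩, ⟨min ε.1 δ.1, lt_min ε.2 δ.2⟩⟩, ?_, ?_⟩
    · exact p.2.sup q.2
    · exact fun b hb ℓ hℓ => (hb ℓ fun y => (hℓ y).trans (le_sup_left (a := p.1 y))).trans
        (min_le_left _ _)
    · exact fun b hb ℓ hℓ => (hb ℓ fun y => (hℓ y).trans (le_sup_right (b := q.1 y))).trans
        (min_le_right _ _)
  have : Nonempty S := ⟨⟨⟨0, by exact continuous_const⟩, ⟨1, one_pos⟩⟩⟩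
  let F : Filter E := ⨅ s, 𝓟 (B s)
  have hF : ∀ s, B s ∈ F := fun s => mem_iInf_of_mem s (mem_principal_self _)
  have : F.NeBot := by
    refine (iInf_neBot_iff_of_directed (fun s t => ?_)).2 fun s => principal_neBot_iff.2 (hne s)
    obtain ⟨r, h1, h2⟩ := hdir s t
    exact ⟨r, principal_mono.2 h1, principal_mono.2 h2⟩
  have hdist : ∀ (p : {p : Seminorm ℂ E // Continuous p}) (ε : {ε : ℝ // 0 < ε}) (b b' : E),
      b ∈ B (p, ε) → b' ∈ B (p, ε) → p.1 (b' - b) ≤ 2 * ε.1 := by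
    intro p ε b b' hb hb'
    obtain ⟨ℓ, h1, h2⟩ := p.1.exists_norming (b' - b)
    have h3 : p.1 (b' - b) = ‖ℓ (b' - b)‖ := by
      rw [h2]; simp [abs_of_nonneg (apply_nonneg p.1 _)]
    have h4 : ℓ (b' - b) = (ℓ b' - ∫ x, ℓ (f x) ∂μ) - (ℓ b - ∫ x, ℓ (f x) ∂μ) := by
      rw [map_sub]; ring
    rw [h3, h4]
    calc _ ≤ ‖ℓ b' - ∫ x, ℓ (f x) ∂μ‖ + ‖ℓ b - ∫ x, ℓ (f x) ∂μ‖ := norm_sub_le _ _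
      _ ≤ ε.1 + ε.1 := add_le_add (hb' ℓ h1) (hb ℓ h1)
      _ = 2 * ε.1 := by ring
  have hcau : Cauchy F := by
    rw [cauchy_iff_le, uniformity_eq_comap_nhds_zero, ← tendsto_iff_comap,
      (PolynormableSpace.withSeminorms ℂ E).tendsto_nhds]
    intro p ε hε
    refine mem_of_superset (prod_mem_prod (hF (p, ⟨ε / 3, by positivity⟩))
      (hF (p, ⟨ε / 3, by positivity⟩))) ?_
    rintro ⟨b, b'⟩ ⟨hb, hb'⟩
    have := hdist p ⟨ε / 3, by positivity⟩ b b' hb hb'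
    simp only [Set.mem_ofPred_eq, sub_zero]
    refine this.trans_lt ?_
    linarith
  obtain ⟨a, ha⟩ := CompleteSpace.complete hcau
  refine ⟨a, fun ℓ => ?_⟩
  let p : Seminorm ℂ E := (normSeminorm ℂ ℂ).comp ℓ.toLinearMap
  have hp : Continuous p := ℓ.continuous.norm
  rw [← sub_eq_zero, ← norm_eq_zero]
  refine le_antisymm (le_of_forall_pos_le_add fun ε hε => ?_) (norm_nonneg _)
  rw [zero_add]
  have hclosed : IsClosed {b : E | ‖ℓ b - ∫ x, ℓ (f x) ∂μ‖ ≤ ε} :=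
    isClosed_le (by fun_prop) continuous_const
  have hsub : {b : E | ‖ℓ b - ∫ x, ℓ (f x) ∂μ‖ ≤ ε} ∈ F :=
    mem_of_superset (hF (⟨p, hp⟩, ⟨ε, hε⟩)) fun b hb => hb ℓ.toLinearMap fun y => le_rfl
  have hmem : a ∈ {b : E | ‖ℓ b - ∫ x, ℓ (f x) ∂μ‖ ≤ ε} :=
    hclosed.mem_of_tendsto (f := id) (b := F) ha hsub
  exact hmem

theorem isWeakIntegral_weakIntegral [CompleteSpace E] [TopologicalSpace X]
    [OpensMeasurableSpace X] (μ : Measure X) [IsFiniteMeasureOnCompacts μ] {f : X → E}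
    (hf : Continuous f) (hfs : HasCompactSupport f) :
    IsWeakIntegral μ f (weakIntegral μ f) := by
  have h := exists_isWeakIntegral μ hf hfs
  rw [weakIntegral, dif_pos h]
  exact h.choose_spec

theorem seminorm_weakIntegral_le [CompleteSpace E] [TopologicalSpace X]
    [OpensMeasurableSpace X] (μ : Measure X) [IsFiniteMeasureOnCompacts μ] {f : X → E}
    (hf : Continuous f) (hfs : HasCompactSupport f) {p : Seminorm ℂ E} (hp : Continuous p) :
    p (weakIntegral μ f) ≤ ∫ x, p (f x) ∂μ := by
  obtain ⟨ℓ, h1, h2⟩ := p.exists_norming (weakIntegral μ f)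
  have h3 := isWeakIntegral_weakIntegral μ hf hfs ⟨ℓ, continuous_of_le_seminorm hp h1⟩
  have h4 : p (weakIntegral μ f) = ‖ℓ (weakIntegral μ f)‖ := by
    rw [h2]; simp [abs_of_nonneg (apply_nonneg p _)]
  rw [h4]
  have h5 : ℓ (weakIntegral μ f) = ∫ x, ℓ (f x) ∂μ := h3
  rw [h5]
  refine norm_integral_le_of_norm_le ?_ (Eventually.of_forall fun x => h1 (f x))
  refine (hp.comp hf).integrable_of_hasCompactSupport ?_
  exact hfs.comp_left (map_zero p)

theorem weakIntegral_eq [T2Space E] {μ : Measure X} {f : X → E} {a : E}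
    (h : IsWeakIntegral μ f a) : weakIntegral μ f = a := by
  have h' : ∃ a, IsWeakIntegral μ f a := ⟨a, h⟩
  rw [weakIntegral, dif_pos h']
  exact h'.choose_spec.unique h

section Lemmas

variable [CompleteSpace E] [T2Space E] [TopologicalSpace X] [OpensMeasurableSpace X]
  (μ : Measure X) [IsFiniteMeasureOnCompacts μ]

theorem weakIntegral_add {f g : X → E} (hf : Continuous f) (hfs : HasCompactSupport f)
    (hg : Continuous g) (hgs : HasCompactSupport g) :
    weakIntegral μ (fun x => f x + g x) = weakIntegral μ f + weakIntegral μ g := by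
  refine weakIntegral_eq fun ℓ => ?_
  have h1 : Integrable (fun x => ℓ (f x)) μ :=
    (ℓ.continuous.comp hf).integrable_of_hasCompactSupport (hfs.comp_left (map_zero ℓ))
  have h2 : Integrable (fun x => ℓ (g x)) μ :=
    (ℓ.continuous.comp hg).integrable_of_hasCompactSupport (hgs.comp_left (map_zero ℓ))
  simp only [map_add]
  rw [isWeakIntegral_weakIntegral μ hf hfs ℓ, isWeakIntegral_weakIntegral μ hg hgs ℓ,
    integral_add h1 h2]

/-- Continuous linear maps commute with the integral. -/
theorem weakIntegral_map {E' : Type*} [AddCommGroup E'] [Module ℂ E'] [UniformSpace E']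
    [IsUniformAddGroup E'] [PolynormableSpace ℂ E'] [T2Space E'] (T : E →L[ℂ] E')
    {f : X → E} (hf : Continuous f) (hfs : HasCompactSupport f) :
    weakIntegral μ (fun x => T (f x)) = T (weakIntegral μ f) :=
  weakIntegral_eq fun ℓ => isWeakIntegral_weakIntegral μ hf hfs (ℓ.comp T)

theorem weakIntegral_sub {f g : X → E} (hf : Continuous f) (hfs : HasCompactSupport f)
    (hg : Continuous g) (hgs : HasCompactSupport g) :
    weakIntegral μ (fun x => f x - g x) = weakIntegral μ f - weakIntegral μ g := by
  have h := weakIntegral_add μ (f := fun x => f x - g x) (hf.sub hg) (hfs.sub hgs) hg hgs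
  rw [eq_sub_iff_add_eq, ← h]
  simp

theorem continuous_weakIntegral {Y : Type*} [TopologicalSpace Y] [LocallyCompactSpace Y]
    {F : Y → X → E} (hF : Continuous F.uncurry) {K : Set X} (hK : IsCompact K)
    (hFK : ∀ y x, x ∉ K → F y x = 0) (hFs : ∀ y, HasCompactSupport (F y)) :
    Continuous fun y => weakIntegral μ (F y) := by
  have hFy : ∀ y, Continuous (F y) := fun y => hF.comp (Continuous.prodMk_right y)
  rw [continuous_iff_continuousAt]
  intro y₀
  rw [ContinuousAt, (PolynormableSpace.withSeminorms ℂ E).tendsto_nhds]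
  rintro ⟨p, hp⟩ ε hε
  have hcont : Continuous fun y => ∫ x, p (F y x - F y₀ x) ∂μ := by
    rw [← continuousOn_univ]
    refine continuousOn_integral_of_compact_support hK ?_ ?_
    · refine Continuous.continuousOn (hp.comp (hF.sub ?_))
      exact (hFy y₀).comp continuous_snd
    · intro y x _ hx
      simp [hFK y x hx, hFK y₀ x hx]
  have h0 : Tendsto (fun y => ∫ x, p (F y x - F y₀ x) ∂μ) (𝓝 y₀) (𝓝 0) :=
    hcont.tendsto' y₀ 0 (by simp)
  filter_upwards [h0.eventually (gt_mem_nhds hε)] with y hy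
  refine lt_of_le_of_lt ?_ hy
  rw [← weakIntegral_sub μ (hFy y) (hFs y) (hFy y₀) (hFs y₀)]
  exact seminorm_weakIntegral_le μ ((hFy y).sub (hFy y₀)) ((hFs y).sub (hFs y₀)) hp

end Lemmas

end WeakIntegral

/-! ### Locally C*-algebras and their dynamical systems -/

/-- A C*-seminorm. -/
structure IsCStarSeminorm {A : Type*} [NonUnitalRing A] [Star A] [Module ℂ A]
    (p : Seminorm ℂ A) : Prop where
  map_mul_le : ∀ a b, p (a * b) ≤ p a * p b
  map_star_mul_self : ∀ a, p (star a * a) = p a ^ 2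

theorem IsCStarSeminorm.map_star {A : Type*} [NonUnitalRing A] [StarRing A] [Module ℂ A]
    {p : Seminorm ℂ A} (hp : IsCStarSeminorm p) (a : A) : p (star a) = p a := by
  have key : ∀ b, p b ≤ p (star b) := fun b => by
    by_contra h
    push Not at h
    have h1 := hp.map_star_mul_self b
    have h2 := hp.map_mul_le (star b) b
    have h3 := apply_nonneg p (star b)
    nlinarith
  refine le_antisymm ?_ (key a)
  simpa using key (star a)

/-- A locally C*-algebra: a complete Hausdorff complex topological `*`-algebra whose topology is
determined by a family of C*-seminorms. -/
class LocallyCStarAlgebra (A : Type*) [NonUnitalRing A] [StarRing A] [Module ℂ A]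
    [IsScalarTower ℂ A A] [SMulCommClass ℂ A A] [StarModule ℂ A] [UniformSpace A] : Prop
    extends IsUniformAddGroup A, ContinuousSMul ℂ A, ContinuousMul A, ContinuousStar A,
      CompleteSpace A, T2Space A where
  exists_withSeminorms : ∃ S : Set (Seminorm ℂ A),
    (∀ p ∈ S, IsCStarSeminorm p) ∧ WithSeminorms (fun p : S => (p : Seminorm ℂ A))

section Action

variable (G : Type*) [Group G] [TopologicalSpace G]
  (A : Type*) [NonUnitalRing A] [StarRing A] [Module ℂ A] [IsScalarTower ℂ A A]
  [SMulCommClass ℂ A A] [StarModule ℂ A] [UniformSpace A]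

instance [LocallyCStarAlgebra A] : PolynormableSpace ℂ A := by
  obtain ⟨S, -, hS⟩ := LocallyCStarAlgebra.exists_withSeminorms (A := A)
  exact hS.toPolynormableSpace

/-- A continuous action of `G` on `A` by `*`-automorphisms: a group homomorphism `t ↦ α_t` such
that `(t, a) ↦ α_t a` is jointly continuous. (Joint continuity makes every `α_t` a
homeomorphism, with inverse `α_{t⁻¹}`.) -/
structure ContinuousAction where
  toHom : G →* (A ≃⋆ₐ[ℂ] A)
  continuous_toHom : Continuous fun x : G × A => toHom x.1 x.2

variable {G A}

instance : CoeFun (ContinuousAction G A) fun _ => G → A ≃⋆ₐ[ℂ] A := ⟨fun α => α.toHom⟩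

namespace ContinuousAction

variable (α : ContinuousAction G A)

theorem continuous_comp {X : Type*} [TopologicalSpace X] {f : X → G} {g : X → A}
    (hf : Continuous f) (hg : Continuous g) : Continuous fun x => α (f x) (g x) :=
  α.continuous_toHom.comp (hf.prodMk hg)

/-- The data presenting `(G, A, α)` as the inverse limit of an inverse system
`(G, B δ, act δ)` of C*-algebras with actions of `G`, with canonical maps `proj δ : A → B δ`. -/
structure InverseLimitPresentation (Δ : Type*) [Preorder Δ] (B : Δ → Type*)
    [∀ δ, NonUnitalCStarAlgebra (B δ)] where
  /-- the connecting maps of the inverse system -/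
  conn : ∀ {δ ε : Δ}, δ ≤ ε → (B ε →⋆ₙₐ[ℂ] B δ)
  conn_refl : ∀ (δ : Δ) (b : B δ), conn (le_refl δ) b = b
  conn_conn : ∀ {δ ε ζ : Δ} (h : δ ≤ ε) (h' : ε ≤ ζ) (b : B ζ),
    conn h (conn h' b) = conn (h.trans h') b
  /-- the actions on the algebras of the system, compatible with the connecting maps -/
  act : ∀ δ, G →* (B δ ≃⋆ₐ[ℂ] B δ)
  conn_act : ∀ {δ ε : Δ} (h : δ ≤ ε) (t : G) (b : B ε), conn h (act ε t b) = act δ t (conn h b)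
  /-- the canonical maps; the next three fields say that they identify `A`, as a topological
  `*`-algebra, with the inverse limit of the algebras `B δ` -/
  proj : ∀ δ, A →⋆ₙₐ[ℂ] B δ
  conn_proj : ∀ {δ ε : Δ} (h : δ ≤ ε) (a : A), conn h (proj ε a) = proj δ a
  isEmbedding_proj : IsEmbedding fun (a : A) (δ : Δ) => proj δ a
  exists_proj_eq : ∀ b : ∀ δ, B δ, (∀ {δ ε : Δ} (h : δ ≤ ε), conn h (b ε) = b δ) →
    ∃ a, ∀ δ, proj δ a = b δ
  /-- `α_t` is the inverse limit of the `act δ t` -/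
  proj_act : ∀ (δ : Δ) (t : G) (a : A), proj δ (α t a) = act δ t (proj δ a)

/-- `α` is an inverse limit action: `A` can be written as the inverse limit, over a directed set,
of C*-algebras with actions of `G` of which `α` is the inverse limit. -/
def IsInverseLimitAction : Prop :=
  ∃ (Δ : Type v) (_ : Preorder Δ) (_ : IsDirectedOrder Δ) (_ : Nonempty Δ) (B : Δ → Type w)
    (_ : ∀ δ, NonUnitalCStarAlgebra (B δ)), Nonempty (α.InverseLimitPresentation Δ B)

/-- The `G`-invariant continuous C*-seminorms on `A`. -/
structure InvSeminorm where
  toSeminorm : Seminorm ℂ A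
  continuous_toSeminorm : Continuous toSeminorm
  isCStarSeminorm : IsCStarSeminorm toSeminorm
  invariant : ∀ (t : G) (a : A), toSeminorm (α t a) = toSeminorm a

end ContinuousAction

end Action

/-! ### The modular function -/

section Modular

open scoped Pointwise

variable {G : Type*} [Group G] [TopologicalSpace G] [IsTopologicalGroup G]
  [LocallyCompactSpace G]

/-- The modular function `γ` of `G`: `μ (E t) = γ t * μ E` for a left Haar measure `μ`.
(Mathlib's modular character is defined through `μ (E t⁻¹)`.) -/
def modularFunction (t : G) : ℝ := ((Measure.modularCharacterFun t : ℝ))⁻¹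

theorem modularFunction_pos (t : G) : 0 < modularFunction t :=
  inv_pos.2 (by exact_mod_cast Measure.modularCharacterFun_pos t)

theorem modularFunction_inv (t : G) : (modularFunction t)⁻¹ = modularFunction t⁻¹ := by
  have h : Measure.modularCharacterFun t * Measure.modularCharacterFun t⁻¹ = 1 := by
    rw [← Measure.modularCharacterFun_map_mul, mul_inv_cancel,
      Measure.modularCharacterFun_map_one]
  have h' : (Measure.modularCharacterFun t : ℝ) * Measure.modularCharacterFun t⁻¹ = 1 := by
    exact_mod_cast h
  simp only [modularFunction, inv_inv]
  exact eq_inv_of_mul_eq_one_left h'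

variable [MeasurableSpace G] [BorelSpace G] (μ : Measure G) [μ.IsHaarMeasure]

theorem integral_mul_right_eq_modularFunction {f : G → ℝ} (hf : Continuous f)
    (hfs : HasCompactSupport f) (t : G) :
    ∫ s, f (s * t) ∂μ = (modularFunction t)⁻¹ * ∫ s, f s ∂μ := by
  have h1 : ∫ s, f s ∂(Measure.map (· * t) μ) = ∫ s, f (s * t) ∂μ := by
    rw [integral_map (by fun_prop) hf.aestronglyMeasurable]
  rw [← h1, Measure.integral_isMulLeftInvariant_eq_smul_of_hasCompactSupport _ μ hf hfs,
    ← Measure.modularCharacterFun_eq_haarScalarFactor, integral_smul_nnreal_measure,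
    modularFunction, inv_inv]
  rfl

theorem continuous_modularFunction_inv : Continuous fun t : G => (modularFunction t)⁻¹ := by
  borelize G
  let μ : Measure G := Measure.haar
  obtain ⟨⟨f, f_cont⟩, f_comp, f_nonneg, f_one⟩ :
    ∃ f : C(G, ℝ), HasCompactSupport f ∧ 0 ≤ f ∧ f 1 ≠ 0 := exists_continuous_nonneg_pos 1
  have hpos : 0 < ∫ x, f x ∂μ :=
    f_cont.integral_pos_of_hasCompactSupport_nonneg_nonzero f_comp f_nonneg f_one
  have h : (fun t : G => (modularFunction t)⁻¹) = fun t => (∫ s, f (s * t) ∂μ) / ∫ s, f s ∂μ := by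
    funext t
    rw [integral_mul_right_eq_modularFunction μ f_cont f_comp, mul_div_cancel_right₀ _ hpos.ne']
  rw [h]
  refine Continuous.div_const ?_ _
  rw [continuous_iff_continuousAt]
  intro t₀
  obtain ⟨V, hV, hVt⟩ := exists_compact_mem_nhds t₀
  have hK : IsCompact (tsupport f * V⁻¹) := IsCompact.mul f_comp hV.inv
  refine ContinuousOn.continuousAt (s := V) ?_ hVt
  refine continuousOn_integral_of_compact_support hK (by fun_prop) ?_
  intro t s ht hs
  by_contra hne
  exact hs ⟨s * t, subset_tsupport _ hne, t⁻¹, Set.inv_mem_inv.2 ht, by simp⟩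

theorem continuous_modularFunction : Continuous (modularFunction : G → ℝ) := by
  have h : (modularFunction : G → ℝ) = fun t => (modularFunction t⁻¹)⁻¹ := by
    funext t; rw [modularFunction_inv, inv_inv]
  rw [h]
  exact continuous_modularFunction_inv.comp continuous_inv

/-- `∫ γ(t)⁻¹ f(t⁻¹) dt = ∫ f(t) dt`. -/
theorem integral_modularFunction_inv_mul {f : G → ℝ} (hf : Continuous f)
    (hfs : HasCompactSupport f) :
    ∫ t, (modularFunction t)⁻¹ * f t⁻¹ ∂μ = ∫ t, f t ∂μ := by
  obtain ⟨⟨g, hg⟩, hgs, g_nonneg, g_one⟩ :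
    ∃ f : C(G, ℝ), HasCompactSupport f ∧ 0 ≤ f ∧ f 1 ≠ 0 := exists_continuous_nonneg_pos 1
  have hpos : 0 < ∫ x, g x ∂μ :=
    hg.integral_pos_of_hasCompactSupport_nonneg_nonzero hgs g_nonneg g_one
  replace hgs : HasCompactSupport g := hgs
  have hf' : Continuous fun t : G => f t⁻¹ := by fun_prop
  have step1 : ∫ t, (∫ s, g (s * t) * f t⁻¹ ∂μ) ∂μ = ∫ s, (∫ t, g (s * t) * f t⁻¹ ∂μ) ∂μ := by
    refine integral_integral_swap_of_hasCompactSupport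
      (f := fun t s => g (s * t) * f t⁻¹) (by fun_prop) ?_
    have hK : IsCompact ((tsupport f)⁻¹ ×ˢ (tsupport g * tsupport f)) :=
      (IsCompact.inv hfs).prod (IsCompact.mul hgs hfs)
    refine HasCompactSupport.of_support_subset_isCompact hK ?_
    rintro ⟨t, s⟩ hts
    have h1 : g (s * t) ≠ 0 := left_ne_zero_of_mul hts
    have h2 : f t⁻¹ ≠ 0 := right_ne_zero_of_mul hts
    exact ⟨subset_tsupport _ h2, s * t, subset_tsupport _ h1, t⁻¹, subset_tsupport _ h2, by simp⟩
  have step2 : ∫ s, (∫ t, g t * f (t⁻¹ * s) ∂μ) ∂μ = ∫ t, (∫ s, g t * f (t⁻¹ * s) ∂μ) ∂μ := by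
    refine integral_integral_swap_of_hasCompactSupport
      (f := fun s t => g t * f (t⁻¹ * s)) (by fun_prop) ?_
    have hK : IsCompact ((tsupport g * tsupport f) ×ˢ tsupport g) :=
      (IsCompact.mul hgs hfs).prod hgs
    refine HasCompactSupport.of_support_subset_isCompact hK ?_
    rintro ⟨s, t⟩ hts
    have h1 : g t ≠ 0 := left_ne_zero_of_mul hts
    have h2 : f (t⁻¹ * s) ≠ 0 := right_ne_zero_of_mul hts
    exact ⟨⟨t, subset_tsupport _ h1, t⁻¹ * s, subset_tsupport _ h2, by simp⟩,
      subset_tsupport _ h1⟩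
  have e1 : ∀ t, ∫ s, g (s * t) * f t⁻¹ ∂μ = (∫ s, g s ∂μ) * ((modularFunction t)⁻¹ * f t⁻¹) := by
    intro t
    rw [integral_mul_const, integral_mul_right_eq_modularFunction μ hg hgs]
    ring
  have e2 : ∀ s, ∫ t, g (s * t) * f t⁻¹ ∂μ = ∫ t, g t * f (t⁻¹ * s) ∂μ := by
    intro s
    rw [← integral_mul_left_eq_self (μ := μ) (fun t => g t * f (t⁻¹ * s)) s]
    simp
  have e3 : ∀ t, ∫ s, g t * f (t⁻¹ * s) ∂μ = g t * ∫ s, f s ∂μ := by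
    intro t
    rw [integral_const_mul, integral_mul_left_eq_self]
  simp only [e1, e2] at step1
  simp only [e3] at step2
  rw [step2, integral_const_mul, integral_mul_const] at step1
  exact mul_left_cancel₀ hpos.ne' step1

end Modular

/-! ### The convolution algebra `C_c(G, A)` -/

section Convolution

open scoped Pointwise CompactlySupported

variable {G : Type*} [Group G] [TopologicalSpace G] [IsTopologicalGroup G]
  [LocallyCompactSpace G] [T2Space G] [MeasurableSpace G] [BorelSpace G]
  {A : Type*} [NonUnitalRing A] [StarRing A] [Module ℂ A] [IsScalarTower ℂ A A]
  [SMulCommClass ℂ A A] [StarModule ℂ A] [UniformSpace A] [LocallyCStarAlgebra A]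

/-- The space `C_c(G, A)` of continuous functions `G → A` with compact support, with pointwise
addition and scalar multiplication. It is a type of its own, because it is given the convolution
product and the involution determined by `α` and the Haar measure `μ`. -/
def CcAlg (_ : ContinuousAction G A) (_ : Measure G) : Type _ := C_c(G, A)

namespace CcAlg

variable {α : ContinuousAction G A} {μ : Measure G}

instance : AddCommGroup (CcAlg α μ) := inferInstanceAs (AddCommGroup C_c(G, A))

instance : Module ℂ (CcAlg α μ) := inferInstanceAs (Module ℂ C_c(G, A))

instance : FunLike (CcAlg α μ) G A := inferInstanceAs (FunLike C_c(G, A) G A)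

/-- A compactly supported continuous function as an element of `CcAlg α μ`. -/
def mk (f : G → A) (hf : Continuous f) (hfs : HasCompactSupport f) : CcAlg α μ :=
  (⟨⟨f, hf⟩, hfs⟩ : C_c(G, A))

@[simp] theorem mk_apply (f : G → A) (hf : Continuous f) (hfs : HasCompactSupport f) (t : G) :
    (mk f hf hfs : CcAlg α μ) t = f t := rfl

@[ext] theorem ext {f g : CcAlg α μ} (h : ∀ t, f t = g t) : f = g := DFunLike.ext _ _ h

theorem continuous (f : CcAlg α μ) : Continuous f :=
  map_continuous (show C_c(G, A) from f)

theorem hasCompactSupport (f : CcAlg α μ) : HasCompactSupport f :=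
  CompactlySupportedContinuousMap.hasCompactSupport (show C_c(G, A) from f)

@[simp] theorem zero_apply (t : G) : (0 : CcAlg α μ) t = 0 := rfl
@[simp] theorem add_apply (f g : CcAlg α μ) (t : G) : (f + g) t = f t + g t := rfl
@[simp] theorem sub_apply (f g : CcAlg α μ) (t : G) : (f - g) t = f t - g t := rfl
@[simp] theorem smul_apply (c : ℂ) (f : CcAlg α μ) (t : G) : (c • f) t = c • f t := rfl

theorem continuous_kernel (f h : CcAlg α μ) :
    Continuous (Function.uncurry fun s t => f t * α t (h (t⁻¹ * s))) := by
  refine (f.continuous.comp continuous_snd).mul (α.continuous_comp continuous_snd ?_)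
  exact h.continuous.comp (by fun_prop)

theorem kernel_eq_zero (f h : CcAlg α μ) (s t : G) (ht : t ∉ tsupport f) :
    f t * α t (h (t⁻¹ * s)) = 0 := by
  rw [image_eq_zero_of_notMem_tsupport ht, zero_mul]

theorem continuous_kernel_right (f h : CcAlg α μ) (s : G) :
    Continuous fun t => f t * α t (h (t⁻¹ * s)) :=
  (continuous_kernel f h).comp (Continuous.prodMk_right s)

theorem hasCompactSupport_kernel_right (f h : CcAlg α μ) (s : G) :
    HasCompactSupport fun t => f t * α t (h (t⁻¹ * s)) :=
  HasCompactSupport.of_support_subset_isCompact f.hasCompactSupport fun t ht => by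
    by_contra h'
    exact ht (kernel_eq_zero f h s t h')

variable [μ.IsHaarMeasure]

theorem hasCompactSupport_convolution (f h : CcAlg α μ) :
    HasCompactSupport fun s => weakIntegral μ fun t => f t * α t (h (t⁻¹ * s)) := by
  refine HasCompactSupport.of_support_subset_isCompact
    (f.hasCompactSupport.isCompact.mul h.hasCompactSupport.isCompact) fun s hs => ?_
  by_contra hs'
  refine hs (weakIntegral_eq fun ℓ => ?_)
  have : ∀ t, f t * α t (h (t⁻¹ * s)) = 0 := fun t => by
    by_contra hne
    refine hs' ⟨t, subset_tsupport _ (left_ne_zero_of_mul hne), t⁻¹ * s,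
      subset_tsupport _ fun h0 => hne ?_, by simp⟩
    rw [h0, map_zero, mul_zero]
  simp [this]

/-- The convolution `(f × h)(s) = ∫ f(t) α_t(h(t⁻¹ s)) dt`. -/
instance : Mul (CcAlg α μ) :=
  ⟨fun f h => mk (fun s => weakIntegral μ fun t => f t * α t (h (t⁻¹ * s)))
    (continuous_weakIntegral μ (continuous_kernel f h) f.hasCompactSupport
      (kernel_eq_zero f h) (hasCompactSupport_kernel_right f h))
    (hasCompactSupport_convolution f h)⟩

theorem mul_apply (f h : CcAlg α μ) (s : G) :
    (f * h) s = weakIntegral μ fun t => f t * α t (h (t⁻¹ * s)) := rfl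

theorem isWeakIntegral_mul (f h : CcAlg α μ) (s : G) :
    IsWeakIntegral μ (fun t => f t * α t (h (t⁻¹ * s))) ((f * h) s) :=
  isWeakIntegral_weakIntegral μ (continuous_kernel_right f h s)
    (hasCompactSupport_kernel_right f h s)

/-- The involution `f^♯(t) = γ(t)⁻¹ α_t(f(t⁻¹)^*)`. -/
instance : Star (CcAlg α μ) :=
  ⟨fun f => mk (fun t => (((modularFunction t)⁻¹ : ℝ) : ℂ) • α t (star (f t⁻¹)))
    ((Complex.continuous_ofReal.comp continuous_modularFunction_inv).smul
      (α.continuous_comp continuous_id (f.continuous.comp continuous_inv).star))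
    (HasCompactSupport.of_support_subset_isCompact f.hasCompactSupport.isCompact.inv fun t ht =>
      subset_tsupport _ fun h0 => ht (by simp [h0]))⟩

theorem star_apply (f : CcAlg α μ) (t : G) :
    star f t = (((modularFunction t)⁻¹ : ℝ) : ℂ) • α t (star (f t⁻¹)) := rfl

instance : NonUnitalNonAssocRing (CcAlg α μ) :=
  { (inferInstance : AddCommGroup (CcAlg α μ)), (inferInstance : Mul (CcAlg α μ)) with
    left_distrib := fun f g h => by
      ext s
      simp only [mul_apply, add_apply, map_add, mul_add]
      exact weakIntegral_add μ (continuous_kernel_right f g s)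
        (hasCompactSupport_kernel_right f g s) (continuous_kernel_right f h s)
        (hasCompactSupport_kernel_right f h s)
    right_distrib := fun f g h => by
      ext s
      simp only [mul_apply, add_apply, add_mul]
      exact weakIntegral_add μ (continuous_kernel_right f h s)
        (hasCompactSupport_kernel_right f h s) (continuous_kernel_right g h s)
        (hasCompactSupport_kernel_right g h s)
    zero_mul := fun f => by
      ext s
      exact weakIntegral_eq fun ℓ => by simp
    mul_zero := fun f => by
      ext s
      exact weakIntegral_eq fun ℓ => by simp }

/-- The seminorm `N_p(f) = ∫ p(f(s)) ds`. -/
def N (p : α.InvSeminorm) : Seminorm ℂ (CcAlg α μ) :=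
  Seminorm.of (fun f => ∫ s, p.1 (f s) ∂μ)
    (fun f g => by
      have hi : ∀ f : CcAlg α μ, Integrable (fun s => p.1 (f s)) μ := fun f =>
        (p.2.comp f.continuous).integrable_of_hasCompactSupport
          (f.hasCompactSupport.comp_left (map_zero p.1))
      rw [← integral_add (hi f) (hi g)]
      exact integral_mono (hi (f + g)) ((hi f).add (hi g)) fun s => map_add_le_add p.1 _ _)
    (fun c f => by
      simp only [smul_apply, map_smul_eq_mul]
      exact integral_const_mul _ _)

theorem N_apply (p : α.InvSeminorm) (f : CcAlg α μ) : N p f = ∫ s, p.1 (f s) ∂μ := rfl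

theorem N_mul_le (p : α.InvSeminorm) (f h : CcAlg α μ) : N p (f * h) ≤ N p f * N p h := by
  obtain ⟨p, hp, hpc, hpi⟩ := p
  simp only [N_apply]
  have hP : ∀ f : CcAlg α μ, Continuous fun s => p (f s) := fun f => hp.comp f.continuous
  have hPs : ∀ f : CcAlg α μ, HasCompactSupport fun s => p (f s) := fun f =>
    f.hasCompactSupport.comp_left (map_zero p)
  have hkc : Continuous (Function.uncurry fun s t => p (f t) * p (h (t⁻¹ * s))) :=
    ((hP f).comp continuous_snd).mul ((hP h).comp (by fun_prop))
  have hks : HasCompactSupport (Function.uncurry fun s t => p (f t) * p (h (t⁻¹ * s))) := by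
    refine HasCompactSupport.of_support_subset_isCompact
      (((hPs f).isCompact.mul (hPs h).isCompact).prod (hPs f).isCompact) ?_
    rintro ⟨s, t⟩ hst
    have h1 : p (f t) ≠ 0 := left_ne_zero_of_mul hst
    have h2 : p (h (t⁻¹ * s)) ≠ 0 := right_ne_zero_of_mul hst
    exact ⟨⟨t, subset_tsupport (fun s => p (f s)) h1, t⁻¹ * s,
      subset_tsupport (fun s => p (h s)) h2, by simp⟩, subset_tsupport (fun s => p (f s)) h1⟩
  have hc1 : Continuous fun s => ∫ t, p (f t) * p (h (t⁻¹ * s)) ∂μ := by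
    rw [← continuousOn_univ]
    refine continuousOn_integral_of_compact_support (hPs f).isCompact hkc.continuousOn ?_
    intro s t _ ht
    have : p (f t) = 0 := image_eq_zero_of_notMem_tsupport (f := fun s => p (f s)) ht
    rw [this, zero_mul]
  have hs1 : HasCompactSupport fun s => ∫ t, p (f t) * p (h (t⁻¹ * s)) ∂μ := by
    refine HasCompactSupport.of_support_subset_isCompact
      ((hPs f).isCompact.mul (hPs h).isCompact) fun s hs => ?_
    by_contra hs'
    refine hs ?_
    have : ∀ t, p (f t) * p (h (t⁻¹ * s)) = 0 := fun t => by
      by_contra hne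
      exact hs' ⟨t, subset_tsupport (fun s => p (f s)) (left_ne_zero_of_mul hne), t⁻¹ * s,
        subset_tsupport (fun s => p (h s)) (right_ne_zero_of_mul hne), by simp⟩
    simp [this]
  calc ∫ s, p ((f * h) s) ∂μ ≤ ∫ s, ∫ t, p (f t) * p (h (t⁻¹ * s)) ∂μ ∂μ := by
        refine integral_mono ((hP (f * h)).integrable_of_hasCompactSupport (hPs (f * h)))
          (hc1.integrable_of_hasCompactSupport hs1) fun s => ?_
        refine (seminorm_weakIntegral_le μ (continuous_kernel_right f h s)
          (hasCompactSupport_kernel_right f h s) hp).trans ?_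
        refine integral_mono ?_ ?_ fun t => ?_
        · exact (hp.comp (continuous_kernel_right f h s)).integrable_of_hasCompactSupport
            ((hasCompactSupport_kernel_right f h s).comp_left (map_zero p))
        · refine (hkc.comp (Continuous.prodMk_right s)).integrable_of_hasCompactSupport ?_
          exact (hPs f).mul_right
        · refine (hpc.map_mul_le _ _).trans_eq ?_
          simp only [hpi]
    _ = ∫ t, ∫ s, p (f t) * p (h (t⁻¹ * s)) ∂μ ∂μ :=
        integral_integral_swap_of_hasCompactSupport hkc hks
    _ = (∫ s, p (f s) ∂μ) * ∫ s, p (h s) ∂μ := by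
        have : ∀ t, ∫ s, p (f t) * p (h (t⁻¹ * s)) ∂μ = p (f t) * ∫ s, p (h s) ∂μ := fun t => by
          rw [integral_const_mul, integral_mul_left_eq_self (μ := μ) (fun s => p (h s)) t⁻¹]
        simp only [this]
        exact integral_mul_const _ _

theorem N_star (p : α.InvSeminorm) (f : CcAlg α μ) : N p (star f) = N p f := by
  obtain ⟨p, hp, hpc, hpi⟩ := p
  simp only [N_apply, star_apply, map_smul_eq_mul, hpi, hpc.map_star]
  rw [← integral_modularFunction_inv_mul μ (f := fun s => p (f s)) (hp.comp f.continuous)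
    (f.hasCompactSupport.comp_left (map_zero p))]
  refine integral_congr_ae (Eventually.of_forall fun t => ?_)
  simp [abs_of_pos (modularFunction_pos t)]

theorem star_add' (f g : CcAlg α μ) : star (f + g) = star f + star g := by
  ext t
  simp [star_apply]

/-- The uniform structure on `C_c(G, A)` defined by the seminorms `N_p`, where `p` runs through
the `G`-invariant continuous C*-seminorms on `A`. -/
instance : UniformSpace (CcAlg α μ) :=
  ⨅ p : α.InvSeminorm, (N (μ := μ) p).toSeminormedAddCommGroup.toUniformSpace

instance : IsUniformAddGroup (CcAlg α μ) :=
  isUniformAddGroup_iInf fun p =>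
    let _ := (N (μ := μ) p).toSeminormedAddCommGroup
    inferInstance

theorem withSeminorms_N : WithSeminorms (fun p : α.InvSeminorm => N (μ := μ) p) :=
  (SeminormFamily.withSeminorms_iff_uniformSpace_eq_iInf _).2 rfl

instance : ContinuousSMul ℂ (CcAlg α μ) := withSeminorms_N.continuousSMul

instance : UniformContinuousConstSMul ℂ (CcAlg α μ) :=
  uniformContinuousConstSMul_of_continuousConstSMul ℂ (CcAlg α μ)

theorem tendsto_N_sub {f₀ : CcAlg α μ} (p : α.InvSeminorm) :
    Tendsto (fun f => N p (f - f₀)) (𝓝 f₀) (𝓝 0) := by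
  have : Continuous fun f => N p (f - f₀) :=
    (withSeminorms_N.continuous_seminorm p).comp (by fun_prop)
  exact this.tendsto' f₀ 0 (by simp)

instance : ContinuousMul (CcAlg α μ) where
  continuous_mul := by
    rw [continuous_iff_continuousAt]
    rintro ⟨f₀, h₀⟩
    rw [ContinuousAt, withSeminorms_N.tendsto_nhds]
    intro p ε hε
    have hN : Continuous fun f : CcAlg α μ => N p f := withSeminorms_N.continuous_seminorm p
    have hb : Continuous fun x : CcAlg α μ × CcAlg α μ =>
        N p (x.1 - f₀) * N p x.2 + N p f₀ * N p (x.2 - h₀) := by fun_prop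
    have h0 := (hb.tendsto' (f₀, h₀) 0 (by simp)).eventually (gt_mem_nhds hε)
    filter_upwards [h0] with x hx
    refine lt_of_le_of_lt ?_ hx
    have e : x.1 * x.2 - f₀ * h₀ = (x.1 - f₀) * x.2 + f₀ * (x.2 - h₀) := by
      rw [sub_mul, mul_sub]; abel
    rw [e]
    exact (map_add_le_add _ _ _).trans (add_le_add (N_mul_le p _ _) (N_mul_le p _ _))

/-- The involution as an additive homomorphism. -/
def starHom : CcAlg α μ →+ CcAlg α μ := AddMonoidHom.mk' star star_add'

theorem uniformContinuous_star : UniformContinuous (star : CcAlg α μ → CcAlg α μ) := by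
  refine uniformContinuous_addMonoidHom_of_continuous (f := starHom)
    (continuous_of_continuousAt_zero starHom ?_)
  rw [ContinuousAt, map_zero, withSeminorms_N.tendsto_nhds]
  intro p ε hε
  have h0 := (tendsto_N_sub (f₀ := (0 : CcAlg α μ)) p).eventually (gt_mem_nhds hε)
  filter_upwards [h0] with f hf
  rw [sub_zero] at hf ⊢
  exact (N_star p f).trans_lt hf

end CcAlg

/-! ### The algebra `L¹(G, A, α)` -/

/-- `L¹(G, A, α)`: the Hausdorff completion of `C_c(G, A)` with respect to the seminorms `N_p`. -/
abbrev L1Alg (α : ContinuousAction G A) (μ : Measure G) [μ.IsHaarMeasure] : Type _ :=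
  Completion (CcAlg α μ)

namespace L1Alg

open Completion IsDenseInducing Function

variable {α : ContinuousAction G A} {μ : Measure G} [μ.IsHaarMeasure]

/-- The product of `L¹(G, A, α)` extends the convolution by continuity. -/
instance : Mul (L1Alg α μ) :=
  ⟨curry <| (isDenseInducing_coe.prodMap isDenseInducing_coe).extend
    ((↑) ∘ uncurry ((· * ·) : CcAlg α μ → CcAlg α μ → CcAlg α μ))⟩

/-- The involution of `L¹(G, A, α)` extends the one of `C_c(G, A)` by continuity. -/
instance : Star (L1Alg α μ) := ⟨Completion.map star⟩

theorem coe_mul (f h : CcAlg α μ) : ((f * h : CcAlg α μ) : L1Alg α μ) = f * h :=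
  ((isDenseInducing_coe.prodMap isDenseInducing_coe).extend_eq
      ((continuous_coe (CcAlg α μ)).comp (@continuous_mul (CcAlg α μ) _ _ _)) (f, h)).symm

theorem coe_star (f : CcAlg α μ) : ((star f : CcAlg α μ) : L1Alg α μ) = star (f : L1Alg α μ) :=
  (Completion.map_coe CcAlg.uniformContinuous_star f).symm

instance : ContinuousMul (L1Alg α μ) where
  continuous_mul := by
    let m := (AddMonoidHom.mul : CcAlg α μ →+ CcAlg α μ →+ CcAlg α μ).compr₂ toCompl
    have : Continuous fun p : CcAlg α μ × CcAlg α μ => m p.1 p.2 :=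
      (continuous_coe (CcAlg α μ)).comp continuous_mul
    have di : IsDenseInducing (toCompl : CcAlg α μ → L1Alg α μ) := isDenseInducing_coe
    exact (di.extend_Z_bilin di this :)

instance : ContinuousStar (L1Alg α μ) := ⟨Completion.continuous_map⟩

instance : NonUnitalNonAssocRing (L1Alg α μ) :=
  { (inferInstance : AddCommGroup (L1Alg α μ)), (inferInstance : Mul (L1Alg α μ)) with
    zero_mul := fun a =>
      Completion.induction_on a (isClosed_eq (by fun_prop) continuous_const)
        fun a => by rw [← coe_zero, ← coe_mul, zero_mul]
    mul_zero := fun a =>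
      Completion.induction_on a (isClosed_eq (by fun_prop) continuous_const)
        fun a => by rw [← coe_zero, ← coe_mul, mul_zero]
    left_distrib := fun a b c =>
      Completion.induction_on₃ a b c
        (isClosed_eq (by fun_prop) (by fun_prop))
        fun a b c => by rw [← coe_add, ← coe_mul, ← coe_mul, ← coe_mul, ← coe_add, mul_add]
    right_distrib := fun a b c =>
      Completion.induction_on₃ a b c
        (isClosed_eq (by fun_prop) (by fun_prop))
        fun a b c => by rw [← coe_add, ← coe_mul, ← coe_mul, ← coe_mul, ← coe_add, add_mul] }

end L1Alg

end Convolution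

/-! ### Representations -/

section Representations

variable (B : Type*) [NonUnitalNonAssocSemiring B] [DistribMulAction ℂ B] [Star B]
  [TopologicalSpace B] (H : Type*) [NormedAddCommGroup H] [InnerProductSpace ℂ H] [CompleteSpace H]

/-- A `*`-representation of the topological `*`-algebra `B` on the Hilbert space `H`: a continuous
`*`-homomorphism into the bounded operators on `H`. -/
structure StarRep where
  toHom : B →⋆ₙₐ[ℂ] (H →L[ℂ] H)
  continuous_toHom : Continuous toHom

variable {B H}

instance : CoeFun (StarRep B H) fun _ => B → H →L[ℂ] H := ⟨fun Φ => Φ.toHom⟩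

/-- Non-degeneracy: the vectors `Φ(b) ξ` span a dense subspace of `H`. -/
def StarRep.IsNondegenerate (Φ : StarRep B H) : Prop :=
  (Submodule.span ℂ {η : H | ∃ (b : B) (ξ : H), Φ b ξ = η}).topologicalClosure = ⊤

variable {G : Type*} [Group G] [TopologicalSpace G]
  {A : Type*} [NonUnitalRing A] [StarRing A] [Module ℂ A] [IsScalarTower ℂ A A]
  [SMulCommClass ℂ A A] [StarModule ℂ A] [UniformSpace A]

/-- A covariant representation `(φ, u, H)` of `(G, A, α)` on the Hilbert space `H`: a
`*`-representation `φ` of `A` and a (strongly continuous) unitary representation `u` of `G` with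
`φ(α_t(a)) = u_t φ(a) u_t^*`. -/
structure CovariantRep (α : ContinuousAction G A) (H : Type*) [NormedAddCommGroup H]
    [InnerProductSpace ℂ H] [CompleteSpace H] where
  φ : StarRep A H
  u : G →* unitary (H →L[ℂ] H)
  continuous_u : ∀ ξ : H, Continuous fun t => (u t : H →L[ℂ] H) ξ
  covariant : ∀ (t : G) (a : A),
    φ (α t a) = (u t : H →L[ℂ] H) * φ a * star (u t : H →L[ℂ] H)

end Representations

end

/-!
Non-degenerate covariant representations `(φ, u)` of `(G, A, α)` correspond to non-degenerate
representations of `L¹(G, A, α)`.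

*From `(φ, u)` to `φ × u`.* By covariance `a ↦ ‖φ(a)‖` is a `G`-invariant continuous C*-seminorm
`p`, so `‖∫ φ(f(t)) u_t dt‖ ≤ N_p(f)`, and the integrated form extends from `C_c(G, A)` to
`L¹(G, A, α)` by continuity (`StarRep.extendL1`). Multiplicativity is Fubini's theorem
(`CovariantRep.integralOp_mul`), compatibility with the involution is the substitution `t ↦ t⁻¹`
(`CovariantRep.integralOp_star`). If `e : G → ℝ` is a bump function of integral one near `s`, then
`(φ × u)(e ⊗ a) ξ` is close to `φ(a) u_s ξ`; this gives both the non-degeneracy of `φ × u`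
(`CovariantRep.isNondegenerate_extendL1`) and the injectivity of the correspondence
(`CovariantRep.eq_of_integratedForm_eq`).

*From `Φ` to `(φ, u)`.* Both `A` and `G` act on `C_c(G, A)` by left multipliers,
`(a f)(t) = a f(t)` and `(s · f)(t) = α_s(f(s⁻¹ t))`, and `φ`, `u` have to be given by
`φ(a) Φ(f) ξ = Φ(a f) ξ` and `u_s Φ(f) ξ = Φ(s · f) ξ`. The second formula defines an isometry,
because `(s · g)^♯ × (s · f) = g^♯ × f` (`CcAlg.star_translate_mul_translate`). The first one
defines a bounded operator, because `Φ(a f) ξ` is the weak limit of `Φ(e ⊗ a) Φ(f) ξ` as `e` runs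
through bump functions at `1`, where `‖Φ(e ⊗ a)‖ ≤ C N_p(e ⊗ a) = C p(a)`
(`StarRep.norm_linearCombination_leftMul_le`); the same estimate makes `φ` continuous.

Both this and the identity `φ × u = Φ` (`StarRep.IsNondegenerate.integratedForm_eq`) rest on
`f × g = ∫ f(t) (t · g) dt` in `L¹(G, A, α)` (`CcAlg.map_mul_eq_integral`). The convolution is only
defined pointwise, by weak integrals in `A`; to integrate in `L¹` one passes to `C(K, A_p)`, where
`K` is a compact set carrying all the functions involved and `A_p` is a Banach space containing
`A` modulo `p`, and uses that the sup norm dominates `N_p` there (`CcAlg.map_eq_integral`).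
-/

open MeasureTheory Filter Topology UniformSpace
open scoped Pointwise InnerProductSpace

set_option linter.unusedSectionVars false

/-! ### Bump functions and Haar integrals -/

section Bump

variable {G : Type*} [Group G] [TopologicalSpace G] [IsTopologicalGroup G]
  [LocallyCompactSpace G] [T2Space G] [MeasurableSpace G] [BorelSpace G]
  (μ : Measure G) [μ.IsHaarMeasure]

theorem exists_bump_integral_eq_one (s : G) {U : Set G} (hU : U ∈ 𝓝 s) :
    ∃ e : G → ℝ, Continuous e ∧ HasCompactSupport e ∧ (∀ t, 0 ≤ e t) ∧ (∀ t, t ∉ U → e t = 0) ∧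
      ∫ t, e t ∂μ = 1 := by
  obtain ⟨g, hg1, hg0, hgc, hg⟩ := exists_continuous_one_zero_of_isCompact (s := {s})
    (t := (interior U)ᶜ) isCompact_singleton isOpen_interior.isClosed_compl
    (by simpa using mem_interior_iff_mem_nhds.2 hU)
  have hpos : 0 < ∫ t, g t ∂μ :=
    g.continuous.integral_pos_of_hasCompactSupport_nonneg_nonzero hgc (fun t => (hg t).1)
      (x := s) (by rw [hg1 rfl]; exact one_ne_zero)
  refine ⟨fun t => (∫ t, g t ∂μ)⁻¹ * g t, by fun_prop, hgc.mul_left,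
    fun t => mul_nonneg (inv_nonneg.2 hpos.le) (hg t).1, fun t ht => ?_, ?_⟩
  · have h0 : g t = 0 := hg0 fun h => ht (interior_subset h)
    simp [h0]
  · rw [integral_const_mul, inv_mul_cancel₀ hpos.ne']

/-- An average of values close to `x` is close to `x`. -/
theorem norm_integral_bump_smul_sub_le {E : Type*} [NormedAddCommGroup E] [NormedSpace ℂ E]
    [CompleteSpace E] {e : G → ℝ} (he : Continuous e) (hes : HasCompactSupport e)
    (he0 : ∀ t, 0 ≤ e t) {U : Set G} (heU : ∀ t, t ∉ U → e t = 0) (he1 : ∫ t, e t ∂μ = 1)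
    {g : G → E} (hg : Continuous g) {x : E} {ε : ℝ} (hε : ∀ t ∈ U, ‖g t - x‖ ≤ ε) :
    ‖∫ t, (e t : ℂ) • g t ∂μ - x‖ ≤ ε := by
  have hi : Integrable (fun t => (e t : ℂ) • g t) μ :=
    Continuous.integrable_of_hasCompactSupport (by fun_prop)
      ((hes.comp_left (g := fun r : ℝ => (r : ℂ)) Complex.ofReal_zero).smul_right)
  have hie : Integrable e μ := he.integrable_of_hasCompactSupport hes
  have hx : x = ∫ t, (e t : ℂ) • x ∂μ := by
    rw [integral_smul_const, integral_complex_ofReal, he1, Complex.ofReal_one, one_smul]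
  have hix : Integrable (fun t => (e t : ℂ) • x) μ := hie.ofReal.smul_const x
  conv_lhs => rw [hx, ← integral_sub hi hix]
  refine (norm_integral_le_of_norm_le (hie.mul_const ε) (Eventually.of_forall fun t => ?_)).trans
    (by rw [integral_mul_const, he1, one_mul])
  rw [← smul_sub, norm_smul, Complex.norm_real, Real.norm_of_nonneg (he0 t)]
  by_cases ht : t ∈ U
  · exact mul_le_mul_of_nonneg_left (hε t ht) (he0 t)
  · rw [heU t ht, zero_mul, zero_mul]

/-- Evaluation at a point of a continuous function is a limit of averages. -/
theorem exists_bump_norm_integral_smul_sub_le {E : Type*} [NormedAddCommGroup E]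
    [NormedSpace ℂ E] [CompleteSpace E] {g : G → E} (hg : Continuous g) (s : G) {ε : ℝ}
    (hε : 0 < ε) :
    ∃ e : G → ℝ, Continuous e ∧ HasCompactSupport e ∧ (∀ t, 0 ≤ e t) ∧ ∫ t, e t ∂μ = 1 ∧
      ‖∫ t, (e t : ℂ) • g t ∂μ - g s‖ ≤ ε := by
  have hU : {t | ‖g t - g s‖ ≤ ε} ∈ 𝓝 s := by
    have : Tendsto (fun t => ‖g t - g s‖) (𝓝 s) (𝓝 0) :=
      Continuous.tendsto' (by fun_prop) s 0 (by simp)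
    filter_upwards [this.eventually (gt_mem_nhds hε)] with t ht using ht.le
  obtain ⟨e, h1, h2, h3, h4, h5⟩ := exists_bump_integral_eq_one μ s hU
  exact ⟨e, h1, h2, h3, h5, norm_integral_bump_smul_sub_le μ h1 h2 h3 h4 h5 hg fun t ht => ht⟩

/-- `∫ γ(t)⁻¹ f(t⁻¹) dt = ∫ f(t) dt` for complex valued `f`. -/
theorem integral_modularFunction_inv_mul_complex {f : G → ℂ} (hf : Continuous f)
    (hfs : HasCompactSupport f) :
    ∫ t, ((((modularFunction t)⁻¹ : ℝ)) : ℂ) * f t⁻¹ ∂μ = ∫ t, f t ∂μ := by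
  have hf' : Continuous fun t : G => f t⁻¹ := by fun_prop
  have hi : Integrable (fun t => ((((modularFunction t)⁻¹ : ℝ)) : ℂ) * f t⁻¹) μ := by
    refine Continuous.integrable_of_hasCompactSupport
      ((Complex.continuous_ofReal.comp continuous_modularFunction_inv).mul hf') ?_
    exact HasCompactSupport.mul_left (hfs.comp_homeomorph (Homeomorph.inv G))
  have hi2 : Integrable f μ := hf.integrable_of_hasCompactSupport hfs
  apply Complex.ext
  · rw [← RCLike.re_eq_complex_re, ← integral_re hi, ← integral_re hi2]
    simp only [RCLike.re_eq_complex_re, Complex.re_ofReal_mul]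
    exact integral_modularFunction_inv_mul μ (f := fun t => (f t).re) (by fun_prop)
      (hfs.comp_left Complex.zero_re)
  · rw [← RCLike.im_eq_complex_im, ← integral_im hi, ← integral_im hi2]
    simp only [RCLike.im_eq_complex_im, Complex.im_ofReal_mul]
    exact integral_modularFunction_inv_mul μ (f := fun t => (f t).im) (by fun_prop)
      (hfs.comp_left Complex.zero_im)

/-- `∫ f(s t) ds = γ(t)⁻¹ ∫ f(s) ds` for complex valued `f`. -/
theorem integral_mul_right_eq_modularFunction_complex {f : G → ℂ} (hf : Continuous f)
    (hfs : HasCompactSupport f) (t : G) :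
    ∫ s, f (s * t) ∂μ = (((modularFunction t)⁻¹ : ℝ) : ℂ) * ∫ s, f s ∂μ := by
  have hft : Continuous fun s : G => f (s * t) := by fun_prop
  have hi : Integrable (fun s => f (s * t)) μ :=
    hft.integrable_of_hasCompactSupport (hfs.comp_homeomorph (Homeomorph.mulRight t))
  have hi2 : Integrable f μ := hf.integrable_of_hasCompactSupport hfs
  apply Complex.ext
  · rw [Complex.re_ofReal_mul]
    rw [← RCLike.re_eq_complex_re, ← integral_re hi, ← integral_re hi2]
    exact integral_mul_right_eq_modularFunction μ (f := fun t => (f t).re) (by fun_prop)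
      (hfs.comp_left Complex.zero_re) t
  · rw [Complex.im_ofReal_mul]
    rw [← RCLike.im_eq_complex_im, ← integral_im hi, ← integral_im hi2]
    exact integral_mul_right_eq_modularFunction μ (f := fun t => (f t).im) (by fun_prop)
      (hfs.comp_left Complex.zero_im) t

end Bump

/-! ### Operators determined by their values on a dense span -/

section Extension

variable {ι H : Type*} [NormedAddCommGroup H] [InnerProductSpace ℂ H] [CompleteSpace H]

/-- `v i ↦ w i` extends to a bounded operator if it is bounded on finite linear combinations. -/
theorem exists_clm_of_norm_linearCombination_le {v w : ι → H}
    (hv : (Submodule.span ℂ (Set.range v)).topologicalClosure = ⊤) {C : ℝ}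
    (h : ∀ l : ι →₀ ℂ, ‖Finsupp.linearCombination ℂ w l‖ ≤ C * ‖Finsupp.linearCombination ℂ v l‖) :
    ∃ T : H →L[ℂ] H, (∀ i, T (v i) = w i) ∧ ∀ x, ‖T x‖ ≤ C * ‖x‖ := by
  have hd : DenseRange (Finsupp.linearCombination ℂ v) := by
    rw [DenseRange, ← LinearMap.coe_range, Finsupp.range_linearCombination]
    exact Submodule.dense_iff_topologicalClosure_eq_top.2 hv
  refine ⟨(Finsupp.linearCombination ℂ w).extendOfNorm (Finsupp.linearCombination ℂ v),
    fun i => ?_, LinearMap.norm_extendOfNorm_apply_le hd C h⟩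
  have := LinearMap.extendOfNorm_eq hd ⟨C, h⟩ (Finsupp.single i 1)
  simpa using this

theorem clm_ext_of_dense_span {E : Type*} [NormedAddCommGroup E] [NormedSpace ℂ E] {v : ι → H}
    (hv : (Submodule.span ℂ (Set.range v)).topologicalClosure = ⊤) {S T : H →L[ℂ] E}
    (h : ∀ i, S (v i) = T (v i)) : S = T :=
  ContinuousLinearMap.ext_on (Submodule.dense_iff_topologicalClosure_eq_top.2 hv)
    (by rintro _ ⟨i, rfl⟩; exact h i)

end Extension

/-! ### Functionals and integrals over `C_c(G, A)` -/

/-- Every seminorm is the pull-back of the norm of a Banach space. -/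
theorem Seminorm.exists_banach.{u} {E : Type u} [AddCommGroup E] [Module ℂ E] (p : Seminorm ℂ E) :
    ∃ (F : Type u) (_ : NormedAddCommGroup F) (_ : NormedSpace ℂ F) (_ : CompleteSpace F)
      (j : E →ₗ[ℂ] F), ∀ x, ‖j x‖ = p x := by
  let _ : SeminormedAddCommGroup E := p.toSeminormedAddCommGroup
  let _ : NormedSpace ℂ E := { norm_smul_le := fun a b => (map_smul_eq_mul p a b).le }
  exact ⟨Completion E, inferInstance, inferInstance, inferInstance,
    (Completion.toComplL : E →L[ℂ] Completion E).toLinearMap, fun x => Completion.norm_coe x⟩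

section Fubini

variable {G : Type*} [Group G] [TopologicalSpace G] [IsTopologicalGroup G]
  [LocallyCompactSpace G] [T2Space G] [MeasurableSpace G] [BorelSpace G]
  {A : Type*} [NonUnitalRing A] [StarRing A] [Module ℂ A] [IsScalarTower ℂ A A]
  [SMulCommClass ℂ A A] [StarModule ℂ A] [UniformSpace A] [LocallyCStarAlgebra A]
  {α : ContinuousAction G A} {μ : Measure G} [μ.IsHaarMeasure]

/-- If `I : C_c(G, A)` is pointwise the weak integral of a jointly continuous and compactly
supported family `F t : C_c(G, A)`, then it is its integral for every functional `L` bounded by a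
seminorm `N_p`. Evaluations are not continuous for `N_p`, which is why the integral is taken in
`C(K', E)` for a Banach space `E` inducing `p`: the sup norm controls both the
evaluations and `N_p`, so that `L` comes from a bounded functional `Λ` by the Hahn-Banach theorem. -/
theorem CcAlg.map_eq_integral (p : α.InvSeminorm) (L : CcAlg α μ →ₗ[ℂ] ℂ) {C : ℝ} (hC : 0 ≤ C)
    (hL : ∀ f, ‖L f‖ ≤ C * N p f) (F : G → CcAlg α μ)
    (hF : Continuous fun x : G × G => F x.1 x.2) {K K' : Set G} (hK : IsCompact K)
    (hK' : IsCompact K') (hFK : ∀ t, t ∉ K → F t = 0) (hFK' : ∀ t s, s ∉ K' → F t s = 0)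
    (I : CcAlg α μ) (hI : ∀ s, IsWeakIntegral μ (fun t => F t s) (I s)) :
    L I = ∫ t, L (F t) ∂μ := by
  obtain ⟨E, _, _, _, j, hj⟩ := p.toSeminorm.exists_banach
  have hjc : Continuous j := by
    refine continuous_of_continuousAt_zero j ?_
    rw [ContinuousAt, map_zero]
    refine squeeze_zero_norm (fun x => (hj x).le) ?_
    exact p.continuous_toSeminorm.tendsto' 0 0 (map_zero _)
  let jL : A →L[ℂ] E := ⟨j, hjc⟩
  have : CompactSpace K' := isCompact_iff_compactSpace.1 hK'
  -- the subspace of functions supported in `K'`, on which `N p` is dominated by a sup norm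
  let S : Submodule ℂ (CcAlg α μ) :=
    { carrier := {f | ∀ s, s ∉ K' → f s = 0}
      add_mem' := fun {f g} hf hg s hs => by simp [hf s hs, hg s hs]
      zero_mem' := fun s hs => rfl
      smul_mem' := fun c f hf s hs => by simp [hf s hs] }
  let J : S →ₗ[ℂ] C(K', E) :=
    { toFun := fun f => ⟨fun s => j (f.1 s), hjc.comp (f.1.continuous.comp continuous_subtype_val)⟩
      map_add' := fun f g => by ext s; simp
      map_smul' := fun c f => by ext s; simp }
  have hJapp : ∀ (f : S) (s : K'), J f s = j (f.1 s) := fun _ _ => rfl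
  have hN : ∀ f : S, N p f.1 ≤ μ.real K' * ‖J f‖ := fun f => by
    rw [N_apply]
    have h1 : ∀ s, p.1 (f.1 s) ≤ K'.indicator (fun _ => ‖J f‖) s := fun s => by
      by_cases hs : s ∈ K'
      · rw [Set.indicator_of_mem hs, ← hj]
        exact (J f).norm_coe_le_norm ⟨s, hs⟩
      · rw [Set.indicator_of_notMem hs, f.2 s hs, map_zero]
    refine (integral_mono ?_ ?_ h1).trans_eq ?_
    · exact (p.2.comp f.1.continuous).integrable_of_hasCompactSupport
        (f.1.hasCompactSupport.comp_left (map_zero p.1))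
    · exact (integrable_indicator_iff hK'.measurableSet).2
        (integrableOn_const hK'.measure_lt_top.ne)
    · rw [integral_indicator_const _ hK'.measurableSet, smul_eq_mul]
  have hb : ∀ f : S, ‖(L ∘ₗ S.subtype) f‖ ≤ (C * μ.real K') * ‖J f‖ := fun f => by
    rw [mul_assoc]
    exact (hL f.1).trans (mul_le_mul_of_nonneg_left (hN f) hC)
  obtain ⟨Λ, hΛ, -⟩ := exists_extension_norm_eq (LinearMap.range J)
    ((L ∘ₗ S.subtype).compLeftInverse J)
  have hΛJ : ∀ f : S, Λ (J f) = L f.1 := fun f => by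
    have h1 := hΛ ⟨J f, LinearMap.mem_range_self J f⟩
    rw [LinearMap.compLeftInverse_apply_of_bdd _ _ ⟨_, hb⟩ f _ rfl] at h1
    exact h1
  let F' : G → S := fun t => ⟨F t, hFK' t⟩
  have hIS : ∀ s, s ∉ K' → I s = 0 := fun s hs =>
    (hI s).unique fun ℓ => by simp [hFK' _ s hs]
  let I' : S := ⟨I, hIS⟩
  have hJF : Continuous fun t => J (F' t) := by
    let c : C(G × K', E) := ⟨fun x => j (F x.1 x.2),
      hjc.comp (hF.comp (continuous_fst.prodMk (continuous_subtype_val.comp continuous_snd)))⟩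
    exact c.curry.continuous
  have hJFs : HasCompactSupport fun t => J (F' t) :=
    HasCompactSupport.intro hK fun t ht => by
      have : F' t = 0 := Subtype.ext (hFK t ht)
      rw [this, map_zero]
  have hint : Integrable (fun t => J (F' t)) μ := hJF.integrable_of_hasCompactSupport hJFs
  have key : J I' = ∫ t, J (F' t) ∂μ := by
    ext s
    have h1 := ContinuousLinearMap.integral_comp_comm (ContinuousMap.evalCLM ℂ s) hint
    refine Eq.trans ?_ h1
    simp only [ContinuousMap.evalCLM_apply, hJapp]
    have hFs : Continuous fun t => F t s := hF.comp (Continuous.prodMk_left s.1)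
    have hFss : HasCompactSupport fun t => F t s :=
      HasCompactSupport.intro hK fun t ht => by rw [hFK t ht]; rfl
    have hi2 : Integrable (fun t => jL (F t s)) μ :=
      (jL.continuous.comp hFs).integrable_of_hasCompactSupport (hFss.comp_left (map_zero jL))
    refine (SeparatingDual.eq_iff_forall_dual_eq (R := ℂ)).2 fun ℓ => ?_
    have h2 := hI s (ℓ.comp jL)
    have h3 := ContinuousLinearMap.integral_comp_comm ℓ hi2
    exact h2.trans h3
  calc L I = Λ (J I') := (hΛJ I').symm
    _ = ∫ t, Λ (J (F' t)) ∂μ := by rw [key, ContinuousLinearMap.integral_comp_comm Λ hint]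
    _ = ∫ t, L (F t) ∂μ := by simp only [hΛJ]; rfl

end Fubini

noncomputable section

theorem modularFunction_mul {G : Type*} [Group G] [TopologicalSpace G] [IsTopologicalGroup G]
    [LocallyCompactSpace G] (s t : G) :
    modularFunction (s * t) = modularFunction s * modularFunction t := by
  simp [modularFunction, Measure.modularCharacterFun_map_mul, mul_comm]

namespace CcAlg

variable {G : Type*} [Group G] [TopologicalSpace G] [IsTopologicalGroup G]
  [LocallyCompactSpace G] [T2Space G] [MeasurableSpace G] [BorelSpace G]
  {A : Type*} [NonUnitalRing A] [StarRing A] [Module ℂ A] [IsScalarTower ℂ A A]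
  [SMulCommClass ℂ A A] [StarModule ℂ A] [UniformSpace A] [LocallyCStarAlgebra A]
  {α : ContinuousAction G A} {μ : Measure G}

/-- The function `a f : t ↦ a f(t)`: the action of `a : A` as a left multiplier of `C_c(G, A)`. -/
def leftMul (a : A) (f : CcAlg α μ) : CcAlg α μ :=
  mk (fun t => a * f t) (continuous_const.mul f.continuous) f.hasCompactSupport.mul_left

/-- The function `s · f : t ↦ α_s (f (s⁻¹ t))`: the action of `s : G` as a left multiplier of
`C_c(G, A)`. -/
def translate (s : G) (f : CcAlg α μ) : CcAlg α μ :=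
  mk (fun t => α s (f (s⁻¹ * t)))
    (α.continuous_comp continuous_const (f.continuous.comp (continuous_const_mul s⁻¹)))
    ((f.hasCompactSupport.comp_homeomorph (Homeomorph.mulLeft s⁻¹)).comp_left (map_zero (α s)))

/-- The function `e ⊗ a : t ↦ e(t) a`. -/
def tensor (e : G → ℝ) (he : Continuous e) (hes : HasCompactSupport e) (a : A) : CcAlg α μ :=
  mk (fun t => (e t : ℂ) • a) ((Complex.continuous_ofReal.comp he).smul continuous_const)
    ((hes.comp_left (g := fun r : ℝ => (r : ℂ)) Complex.ofReal_zero).smul_right)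

@[simp] theorem leftMul_apply (a : A) (f : CcAlg α μ) (t : G) : leftMul a f t = a * f t := rfl

@[simp] theorem translate_apply (s : G) (f : CcAlg α μ) (t : G) :
    translate s f t = α s (f (s⁻¹ * t)) := rfl

@[simp] theorem tensor_apply (e : G → ℝ) (he : Continuous e) (hes : HasCompactSupport e) (a : A)
    (t : G) : (tensor e he hes a : CcAlg α μ) t = (e t : ℂ) • a := rfl

theorem add_leftMul (a b : A) (f : CcAlg α μ) : leftMul (a + b) f = leftMul a f + leftMul b f := by
  ext t; simp [add_mul]

theorem smul_leftMul (c : ℂ) (a : A) (f : CcAlg α μ) : leftMul (c • a) f = c • leftMul a f := by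
  ext t; simp [smul_mul_assoc]

theorem mul_leftMul (a b : A) (f : CcAlg α μ) : leftMul (a * b) f = leftMul a (leftMul b f) := by
  ext t; simp [mul_assoc]

theorem one_translate (f : CcAlg α μ) : translate 1 f = f := by
  ext t; simp

theorem mul_translate (s t : G) (f : CcAlg α μ) :
    translate (s * t) f = translate s (translate t f) := by
  ext r; simp [mul_assoc]

theorem translate_leftMul (s : G) (a : A) (f : CcAlg α μ) :
    translate s (leftMul a f) = leftMul (α s a) (translate s f) := by
  ext t; simp

theorem leftMul_zero_left (f : CcAlg α μ) : leftMul 0 f = 0 := by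
  ext t; simp

variable [μ.IsHaarMeasure]

theorem N_tensor (p : α.InvSeminorm) {e : G → ℝ} (he : Continuous e) (hes : HasCompactSupport e)
    (he0 : ∀ t, 0 ≤ e t) (a : A) :
    N p (tensor e he hes a : CcAlg α μ) = (∫ t, e t ∂μ) * p.1 a := by
  have h : ∀ t, p.1 ((e t : ℂ) • a) = e t * p.1 a := fun t => by
    rw [map_smul_eq_mul, Complex.norm_real, Real.norm_of_nonneg (he0 t)]
  simp only [N_apply, tensor_apply, h, integral_mul_const]

theorem star_mul_apply_integrand (f g : CcAlg α μ) (s t : G) :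
    star g t * α t (f (t⁻¹ * s)) =
      (((modularFunction t)⁻¹ : ℝ) : ℂ) • α t (star (g t⁻¹) * f (t⁻¹ * s)) := by
  rw [star_apply, smul_mul_assoc, map_mul (α t)]

/-- Left multiplication by `a` is adjointable, with adjoint the left multiplication by `a^*`. -/
theorem star_mul_leftMul (a : A) (f g : CcAlg α μ) :
    star g * leftMul a f = star (leftMul (star a) g) * f := by
  ext s
  rw [mul_apply, mul_apply]
  congr 1
  funext t
  rw [star_mul_apply_integrand, star_mul_apply_integrand]
  simp [mul_assoc]

/-- Translations are unitary: they preserve the `C_c(G, A)`-valued inner product `g^♯ × f`. -/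
theorem star_translate_mul_translate (r : G) (f g : CcAlg α μ) :
    star (translate r g) * translate r f = star g * f := by
  ext s
  refine weakIntegral_eq fun ℓ => ?_
  rw [isWeakIntegral_mul (star g) f s ℓ]
  have h1 : ∀ t, ℓ (star (translate r g) t * α t (translate r f (t⁻¹ * s))) =
      ((modularFunction r : ℝ) : ℂ) * ℓ (star g (t * r) * α (t * r) (f ((t * r)⁻¹ * s))) := by
    intro t
    have h2 : (modularFunction t)⁻¹ = modularFunction r * (modularFunction (t * r))⁻¹ := by
      have := (modularFunction_pos r).ne'
      have := (modularFunction_pos t).ne'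
      rw [modularFunction_mul]
      field_simp
    rw [star_mul_apply_integrand, star_mul_apply_integrand, h2, Complex.ofReal_mul, mul_smul,
      map_smul, smul_eq_mul, translate_apply, translate_apply, ← map_star (α r)]
    simp [mul_assoc]
  simp only [h1]
  rw [integral_const_mul, integral_mul_right_eq_modularFunction_complex μ
    (f := fun t => ℓ (star g t * α t (f (t⁻¹ * s))))
    (ℓ.continuous.comp (continuous_kernel_right _ _ _))
    ((hasCompactSupport_kernel_right _ _ _).comp_left (map_zero ℓ)), ← mul_assoc,
    ← Complex.ofReal_mul, mul_inv_cancel₀ (modularFunction_pos r).ne', Complex.ofReal_one, one_mul]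

/-- A jointly continuous family of functions whose supports lie locally in a common compact set is
continuous for the seminorms `N_p`. -/
theorem continuous_of_continuous_uncurry {X : Type*} [TopologicalSpace X] {F : X → CcAlg α μ}
    (hF : Continuous fun x : X × G => F x.1 x.2)
    (hK : ∀ x₀, ∃ V ∈ 𝓝 x₀, ∃ K, IsCompact K ∧ ∀ x ∈ V, ∀ s, s ∉ K → F x s = 0) :
    Continuous F := by
  rw [continuous_iff_continuousAt]
  intro x₀
  obtain ⟨V, hV, K, hK, hFK⟩ := hK x₀
  have hx₀ := mem_of_mem_nhds hV
  rw [ContinuousAt, withSeminorms_N.tendsto_nhds]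
  intro p ε hε
  have h1 : ContinuousOn (fun x => ∫ s, p.1 (F x s - F x₀ s) ∂μ) V := by
    refine continuousOn_integral_of_compact_support hK ?_ ?_
    · exact (p.2.comp (hF.sub ((F x₀).continuous.comp continuous_snd))).continuousOn
    · intro x s hx hs
      simp [hFK x hx s hs, hFK x₀ hx₀ s hs]
  have h2 : Tendsto (fun x => ∫ s, p.1 (F x s - F x₀ s) ∂μ) (𝓝 x₀) (𝓝 0) := by
    have := (h1.continuousAt hV).tendsto
    simpa using this
  filter_upwards [h2.eventually (gt_mem_nhds hε)] with x hx using hx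

theorem continuous_translate_uncurry (f : CcAlg α μ) :
    Continuous fun x : G × G => translate x.1 f x.2 :=
  α.continuous_comp continuous_fst (f.continuous.comp (by fun_prop))

theorem translate_eq_zero (f : CcAlg α μ) {V : Set G} {t s : G} (ht : t ∈ V)
    (hs : s ∉ V * tsupport f) : translate t f s = 0 := by
  have h : f (t⁻¹ * s) = 0 :=
    image_eq_zero_of_notMem_tsupport fun h => hs ⟨t, ht, t⁻¹ * s, h, by simp⟩
  rw [translate_apply, h, map_zero]

theorem continuous_leftMul_translate (a : A) (f : CcAlg α μ) :
    Continuous fun t => leftMul a (translate t f) := by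
  refine continuous_of_continuous_uncurry
    (continuous_const.mul (continuous_translate_uncurry f)) fun t₀ => ?_
  obtain ⟨V, hV, hVt⟩ := exists_compact_mem_nhds t₀
  refine ⟨V, hVt, V * tsupport f, hV.mul f.hasCompactSupport, fun t ht s hs => ?_⟩
  rw [leftMul_apply, translate_eq_zero f ht hs, mul_zero]

theorem continuous_translate (f : CcAlg α μ) : Continuous fun t => translate t f := by
  refine continuous_of_continuous_uncurry (continuous_translate_uncurry f) fun t₀ => ?_
  obtain ⟨V, hV, hVt⟩ := exists_compact_mem_nhds t₀
  exact ⟨V, hVt, V * tsupport f, hV.mul f.hasCompactSupport,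
    fun t ht s hs => translate_eq_zero f ht hs⟩

/-- `f × g = ∫ f(t) (t · g) dt`, tested against functionals continuous for the topology of
`L¹(G, A, α)`. -/
theorem map_mul_eq_integral (p : α.InvSeminorm) (L : CcAlg α μ →ₗ[ℂ] ℂ) {C : ℝ} (hC : 0 ≤ C)
    (hL : ∀ f, ‖L f‖ ≤ C * N p f) (f g : CcAlg α μ) :
    L (f * g) = ∫ t, L (leftMul (f t) (translate t g)) ∂μ := by
  refine map_eq_integral p L hC hL (fun t => leftMul (f t) (translate t g)) ?_
    f.hasCompactSupport (f.hasCompactSupport.isCompact.mul g.hasCompactSupport) ?_ ?_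
    (f * g) (isWeakIntegral_mul f g)
  · exact (f.continuous.comp continuous_fst).mul (continuous_translate_uncurry g)
  · intro t ht
    rw [image_eq_zero_of_notMem_tsupport ht, leftMul_zero_left]
  · intro t s hs
    by_cases ht : t ∈ tsupport f
    · rw [leftMul_apply, translate_eq_zero g ht hs, mul_zero]
    · rw [image_eq_zero_of_notMem_tsupport ht, leftMul_zero_left, zero_apply]

/-- The family of seminorms `N_p` is directed. -/
theorem exists_finset_sup_N_le (S : Finset α.InvSeminorm) :
    ∃ p : α.InvSeminorm, ∀ f : CcAlg α μ, (S.sup fun p => N (μ := μ) p) f ≤ N p f := by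
  classical
  induction S using Finset.induction_on with
  | empty =>
    exact ⟨⟨0, continuous_const, ⟨fun _ _ => by simp, fun _ => by simp⟩, fun _ _ => rfl⟩,
      fun f => by simp [N_apply]⟩
  | insert q S _ ih =>
    obtain ⟨p, hp⟩ := ih
    let r : α.InvSeminorm :=
      { toSeminorm := q.1 ⊔ p.1
        continuous_toSeminorm := q.2.sup p.2
        isCStarSeminorm :=
          { map_mul_le := fun a b => by
              refine sup_le ((q.3.map_mul_le a b).trans ?_) ((p.3.map_mul_le a b).trans ?_)
              · exact mul_le_mul le_sup_left le_sup_left (apply_nonneg _ _)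
                  (apply_nonneg (q.1 ⊔ p.1) _)
              · exact mul_le_mul le_sup_right le_sup_right (apply_nonneg _ _)
                  (apply_nonneg (q.1 ⊔ p.1) _)
            map_star_mul_self := fun a => by
              rw [Seminorm.sup_apply, Seminorm.sup_apply, q.3.map_star_mul_self,
                p.3.map_star_mul_self]
              rcases le_total (q.1 a) (p.1 a) with h | h
              · rw [sup_of_le_right h, sup_of_le_right (pow_le_pow_left₀ (apply_nonneg _ _) h 2)]
              · rw [sup_of_le_left h, sup_of_le_left (pow_le_pow_left₀ (apply_nonneg _ _) h 2)] }
        invariant := fun t a => by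
          rw [Seminorm.sup_apply, Seminorm.sup_apply, q.invariant, p.invariant] }
    have hi : ∀ (q : α.InvSeminorm) (f : CcAlg α μ), Integrable (fun s => q.1 (f s)) μ :=
      fun q f => (q.2.comp f.continuous).integrable_of_hasCompactSupport
        (f.hasCompactSupport.comp_left (map_zero q.1))
    refine ⟨r, fun f => ?_⟩
    rw [Finset.sup_insert, Seminorm.sup_apply]
    refine sup_le ?_ ((hp f).trans ?_)
    · exact integral_mono (hi q f) (hi r f) fun s => le_sup_left
    · exact integral_mono (hi p f) (hi r f) fun s => le_sup_right

/-- A continuous linear map from `C_c(G, A)` into a normed space is bounded by one of the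
seminorms `N_p`. -/
theorem exists_norm_le_N {E : Type*} [NormedAddCommGroup E] [NormedSpace ℂ E]
    (L : CcAlg α μ →ₗ[ℂ] E) (hL : Continuous L) :
    ∃ (p : α.InvSeminorm) (C : ℝ), 0 ≤ C ∧ ∀ f, ‖L f‖ ≤ C * N p f := by
  obtain ⟨S, C, -, h⟩ := Seminorm.bound_of_continuous withSeminorms_N
    ((normSeminorm ℂ E).comp L) hL.norm
  obtain ⟨p, hp⟩ := exists_finset_sup_N_le (μ := μ) S
  exact ⟨p, C, C.2, fun f => (h f).trans (mul_le_mul_of_nonneg_left (hp f) C.2)⟩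

end CcAlg

variable {G : Type*} [Group G] [TopologicalSpace G] [IsTopologicalGroup G]
  [LocallyCompactSpace G] [T2Space G] [MeasurableSpace G] [BorelSpace G]
  {A : Type*} [NonUnitalRing A] [StarRing A] [Module ℂ A] [IsScalarTower ℂ A A]
  [SMulCommClass ℂ A A] [StarModule ℂ A] [UniformSpace A] [LocallyCStarAlgebra A]
  {α : ContinuousAction G A} {μ : Measure G} [μ.IsHaarMeasure]
  {H : Type*} [NormedAddCommGroup H] [InnerProductSpace ℂ H] [CompleteSpace H]

/-! ### Restricting representations to `C_c(G, A)` and extending them to `L¹(G, A, α)` -/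

namespace StarRep

theorem isNondegenerate_iff {B : Type*} [NonUnitalNonAssocSemiring B] [DistribMulAction ℂ B]
    [Star B] [TopologicalSpace B] (Φ : StarRep B H) :
    Φ.IsNondegenerate ↔ (Submodule.span ℂ
      (Set.range fun x : B × H => Φ x.1 x.2)).topologicalClosure = ⊤ := by
  have : {η : H | ∃ (b : B) (ξ : H), Φ b ξ = η} = Set.range fun x : B × H => Φ x.1 x.2 := by
    ext η; simp
  rw [IsNondegenerate, this]

/-- A closed subspace containing all `Φ(b) ξ` is everything. -/
theorem IsNondegenerate.eq_top {B : Type*} [NonUnitalNonAssocSemiring B] [DistribMulAction ℂ B]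
    [Star B] [TopologicalSpace B] {Φ : StarRep B H} (h : Φ.IsNondegenerate) {K : Submodule ℂ H}
    (hK : IsClosed (K : Set H)) (hΦ : ∀ b ξ, Φ b ξ ∈ K) : K = ⊤ := by
  rw [eq_top_iff, ← h]
  refine Submodule.topologicalClosure_minimal _ (Submodule.span_le.2 ?_) hK
  rintro _ ⟨b, ξ, rfl⟩
  exact hΦ b ξ

/-- A vector orthogonal to all `Φ(b) ξ` is zero. -/
theorem IsNondegenerate.eq_zero_of_inner {B : Type*} [NonUnitalNonAssocSemiring B]
    [DistribMulAction ℂ B] [Star B] [TopologicalSpace B] {Φ : StarRep B H} (h : Φ.IsNondegenerate)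
    {η : H} (hη : ∀ b ξ, ⟪η, Φ b ξ⟫_ℂ = 0) : η = 0 := by
  have htop : (ℂ ∙ η)ᗮ = ⊤ := h.eq_top (Submodule.isClosed_orthogonal _) fun b ξ =>
    Submodule.mem_orthogonal_singleton_iff_inner_right.2 (hη b ξ)
  have hmem : η ∈ (ℂ ∙ η)ᗮ := htop ▸ Submodule.mem_top
  exact inner_self_eq_zero.1 (Submodule.mem_orthogonal_singleton_iff_inner_right.1 hmem)

@[ext] theorem ext {B : Type*} [NonUnitalNonAssocSemiring B] [DistribMulAction ℂ B]
    [Star B] [TopologicalSpace B] {Φ Ψ : StarRep B H} (h : ∀ b, Φ b = Ψ b) : Φ = Ψ := by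
  cases Φ; cases Ψ
  congr
  exact NonUnitalStarAlgHom.ext h

/-- The extension by continuity to `L¹(G, A, α)` of a representation of `C_c(G, A)`. -/
def extendL1 (Φ : StarRep (CcAlg α μ) H) : StarRep (L1Alg α μ) H :=
  have hu : UniformContinuous Φ.toHom :=
    uniformContinuous_addMonoidHom_of_continuous Φ.continuous_toHom
  have hc : Continuous (Completion.extension Φ.toHom) := Completion.continuous_extension
  have he : ∀ f : CcAlg α μ, Completion.extension Φ.toHom (f : L1Alg α μ) = Φ f :=
    Completion.extension_coe hu
  { toHom :=
      { toFun := Completion.extension Φ.toHom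
        map_smul' := fun z b => by
          induction b using Completion.induction_on with
          | hp =>
            exact isClosed_eq (hc.comp (continuous_const_smul z))
              ((continuous_const_smul z).comp hc)
          | ih f => rw [← Completion.coe_smul, he, he, map_smul]; rfl
        map_zero' := by rw [← Completion.coe_zero, he, map_zero]
        map_add' := fun b b' => by
          induction b, b' using Completion.induction_on₂ with
          | hp =>
            exact isClosed_eq (hc.comp continuous_add)
              ((hc.comp continuous_fst).add (hc.comp continuous_snd))
          | ih f g => rw [← Completion.coe_add, he, he, he, map_add]
        map_mul' := fun b b' => by
          induction b, b' using Completion.induction_on₂ with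
          | hp =>
            exact isClosed_eq (hc.comp continuous_mul)
              ((hc.comp continuous_fst).mul (hc.comp continuous_snd))
          | ih f g => rw [← L1Alg.coe_mul, he, he, he, map_mul]
        map_star' := fun b => by
          induction b using Completion.induction_on with
          | hp => exact isClosed_eq (hc.comp continuous_star) (continuous_star.comp hc)
          | ih f => rw [← L1Alg.coe_star, he, he, map_star] }
    continuous_toHom := hc }

theorem extendL1_coe (Φ : StarRep (CcAlg α μ) H) (f : CcAlg α μ) :
    Φ.extendL1 (f : L1Alg α μ) = Φ f :=
  Completion.extension_coe (uniformContinuous_addMonoidHom_of_continuous Φ.continuous_toHom) f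

/-- The restriction to `C_c(G, A)` of a representation of `L¹(G, A, α)`. -/
def restrictCc (Φ : StarRep (L1Alg α μ) H) : StarRep (CcAlg α μ) H where
  toHom :=
    { toFun := fun f => Φ (f : L1Alg α μ)
      map_smul' := fun z f => by rw [Completion.coe_smul, map_smul]; rfl
      map_zero' := by rw [Completion.coe_zero, map_zero]
      map_add' := fun f g => by rw [Completion.coe_add, map_add]
      map_mul' := fun f g => by rw [L1Alg.coe_mul, map_mul]
      map_star' := fun f => by rw [L1Alg.coe_star, map_star] }
  continuous_toHom := Φ.continuous_toHom.comp (Completion.continuous_coe _)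

theorem restrictCc_apply (Φ : StarRep (L1Alg α μ) H) (f : CcAlg α μ) :
    Φ.restrictCc f = Φ (f : L1Alg α μ) := rfl

/-- Representations of `L¹(G, A, α)` are determined on the dense subalgebra `C_c(G, A)`. -/
theorem ext_of_coe {Φ Ψ : StarRep (L1Alg α μ) H}
    (h : ∀ f : CcAlg α μ, Φ (f : L1Alg α μ) = Ψ (f : L1Alg α μ)) : Φ = Ψ := by
  ext1 b
  induction b using Completion.induction_on with
  | hp => exact isClosed_eq Φ.continuous_toHom Ψ.continuous_toHom
  | ih f => exact h f

theorem IsNondegenerate.restrictCc {Φ : StarRep (L1Alg α μ) H} (h : Φ.IsNondegenerate) :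
    Φ.restrictCc.IsNondegenerate := by
  refine h.eq_top (Submodule.isClosed_topologicalClosure _) fun b ξ => ?_
  induction b using Completion.induction_on with
  | hp =>
    exact (Submodule.isClosed_topologicalClosure _).preimage
      (Φ.continuous_toHom.clm_apply continuous_const)
  | ih f => exact Submodule.le_topologicalClosure _ (Submodule.subset_span ⟨f, ξ, rfl⟩)

end StarRep

/-! ### The integrated form of a covariant representation -/

namespace CovariantRep

@[ext] theorem ext {c d : CovariantRep α H} (hφ : ∀ a, c.φ a = d.φ a)
    (hu : ∀ t ξ, (c.u t : H →L[ℂ] H) ξ = (d.u t : H →L[ℂ] H) ξ) : c = d := by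
  obtain ⟨φ, u, _, _⟩ := c
  obtain ⟨φ', u', _, _⟩ := d
  obtain rfl : φ = φ' := StarRep.ext hφ
  obtain rfl : u = u' := MonoidHom.ext fun t => Subtype.ext (ContinuousLinearMap.ext (hu t))
  rfl

variable (c : CovariantRep α H)

theorem star_u (t : G) : star (c.u t : H →L[ℂ] H) = c.u t⁻¹ := by
  rw [map_inv, ← Unitary.star_eq_inv]; rfl

theorem inner_u_left (t : G) (x y : H) :
    ⟪(c.u t : H →L[ℂ] H) x, y⟫_ℂ = ⟪x, (c.u t⁻¹ : H →L[ℂ] H) y⟫_ℂ := by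
  rw [← star_u, ContinuousLinearMap.star_eq_adjoint, ContinuousLinearMap.adjoint_inner_right]

theorem u_mul_apply (s t : G) (x : H) :
    (c.u (s * t) : H →L[ℂ] H) x = (c.u s : H →L[ℂ] H) ((c.u t : H →L[ℂ] H) x) := by
  rw [map_mul]; rfl

theorem u_one_apply (x : H) : (c.u 1 : H →L[ℂ] H) x = x := by
  rw [map_one]; rfl

theorem norm_u_apply (t : G) (x : H) : ‖(c.u t : H →L[ℂ] H) x‖ = ‖x‖ :=
  ContinuousLinearMap.norm_map_of_mem_unitary (c.u t).2 x

/-- Covariance in the form `φ(α_t(a)) u_t = u_t φ(a)`. -/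
theorem φ_action_u_apply (t : G) (a : A) (x : H) :
    c.φ (α t a) ((c.u t : H →L[ℂ] H) x) = (c.u t : H →L[ℂ] H) (c.φ a x) := by
  rw [c.covariant, star_u, mul_apply_eq_comp, mul_apply_eq_comp,
    ← u_mul_apply, inv_mul_cancel, u_one_apply]

/-- The `G`-invariant C*-seminorm `a ↦ ‖φ(a)‖` of a covariant representation. -/
def invSeminorm : α.InvSeminorm where
  toSeminorm := Seminorm.of (fun a => ‖c.φ a‖)
    (fun a b => by rw [map_add]; exact norm_add_le _ _)
    (fun z a => by rw [map_smul, norm_smul])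
  continuous_toSeminorm := c.φ.continuous_toHom.norm
  isCStarSeminorm :=
    { map_mul_le := fun a b => by
        change ‖c.φ (a * b)‖ ≤ ‖c.φ a‖ * ‖c.φ b‖
        rw [map_mul]; exact norm_mul_le _ _
      map_star_mul_self := fun a => by
        change ‖c.φ (star a * a)‖ = ‖c.φ a‖ ^ 2
        rw [map_mul, map_star, CStarRing.norm_star_mul_self, sq] }
  invariant := fun t a => by
    change ‖c.φ (α t a)‖ = ‖c.φ a‖
    rw [c.covariant, ← Unitary.coe_star, CStarRing.norm_mul_coe_unitary,
      CStarRing.norm_coe_unitary_mul]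

theorem invSeminorm_apply (a : A) : c.invSeminorm.toSeminorm a = ‖c.φ a‖ := rfl

theorem continuous_integrand (f : CcAlg α μ) (ξ : H) :
    Continuous fun t => c.φ (f t) ((c.u t : H →L[ℂ] H) ξ) :=
  (c.φ.continuous_toHom.comp f.continuous).clm_apply (c.continuous_u ξ)

theorem hasCompactSupport_integrand (f : CcAlg α μ) (ξ : H) :
    HasCompactSupport fun t => c.φ (f t) ((c.u t : H →L[ℂ] H) ξ) :=
  HasCompactSupport.intro f.hasCompactSupport fun t ht => by
    rw [image_eq_zero_of_notMem_tsupport ht, map_zero]; rfl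

theorem integrable_integrand (f : CcAlg α μ) (ξ : H) :
    Integrable (fun t => c.φ (f t) ((c.u t : H →L[ℂ] H) ξ)) μ :=
  (c.continuous_integrand f ξ).integrable_of_hasCompactSupport (c.hasCompactSupport_integrand f ξ)

theorem norm_integral_le (f : CcAlg α μ) (ξ : H) :
    ‖∫ t, c.φ (f t) ((c.u t : H →L[ℂ] H) ξ) ∂μ‖ ≤ CcAlg.N c.invSeminorm f * ‖ξ‖ := by
  rw [CcAlg.N_apply, ← integral_mul_const]
  refine norm_integral_le_of_norm_le ?_ (Eventually.of_forall fun t => ?_)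
  · exact ((c.invSeminorm.2.comp f.continuous).integrable_of_hasCompactSupport
      (f.hasCompactSupport.comp_left (map_zero _))).mul_const _
  · rw [invSeminorm_apply, ← c.norm_u_apply t ξ]
    exact ContinuousLinearMap.le_opNorm _ _

/-- The operator `∫ φ(f(t)) u_t dt`. -/
def integralOp (f : CcAlg α μ) : H →L[ℂ] H :=
  LinearMap.mkContinuous
    { toFun := fun ξ => ∫ t, c.φ (f t) ((c.u t : H →L[ℂ] H) ξ) ∂μ
      map_add' := fun ξ η => by
        simp only [map_add]
        exact integral_add (c.integrable_integrand f ξ) (c.integrable_integrand f η)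
      map_smul' := fun z ξ => by
        simp only [map_smul]
        exact integral_smul z _ }
    (CcAlg.N c.invSeminorm f) (c.norm_integral_le f)

theorem integralOp_apply (f : CcAlg α μ) (ξ : H) :
    c.integralOp f ξ = ∫ t, c.φ (f t) ((c.u t : H →L[ℂ] H) ξ) ∂μ := rfl

theorem norm_integralOp_le (f : CcAlg α μ) : ‖c.integralOp f‖ ≤ CcAlg.N c.invSeminorm f :=
  LinearMap.mkContinuous_norm_le _ (apply_nonneg _ _) _

/-- `φ` commutes with weak integrals, in the strong operator topology. -/
theorem φ_apply_eq_integral {F : G → A} (hF : Continuous F) (hFs : HasCompactSupport F) {a : A}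
    (ha : IsWeakIntegral μ F a) (ξ : H) : c.φ a ξ = ∫ t, c.φ (F t) ξ ∂μ := by
  have hi : Integrable (fun t => c.φ (F t) ξ) μ :=
    ((c.φ.continuous_toHom.comp hF).clm_apply continuous_const).integrable_of_hasCompactSupport
      (hFs.comp_left (g := fun a => c.φ a ξ) (by rw [map_zero]; rfl))
  let T : A →L[ℂ] H :=
    { toFun := fun a => c.φ a ξ
      map_add' := fun a b => by rw [map_add]; rfl
      map_smul' := fun z a => by rw [map_smul]; rfl
      cont := c.φ.continuous_toHom.clm_apply continuous_const }
  refine (SeparatingDual.eq_iff_forall_dual_eq (R := ℂ)).2 fun ℓ => ?_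
  exact (ha (ℓ.comp T)).trans (ContinuousLinearMap.integral_comp_comm ℓ hi)

theorem integralOp_mul (f h : CcAlg α μ) :
    c.integralOp (f * h) = c.integralOp f * c.integralOp h := by
  ext ξ
  have hk : Continuous (Function.uncurry fun t s =>
      c.φ (f t * α t (h (t⁻¹ * s))) ((c.u s : H →L[ℂ] H) ξ)) :=
    (c.φ.continuous_toHom.comp ((CcAlg.continuous_kernel f h).comp continuous_swap)).clm_apply
      ((c.continuous_u ξ).comp continuous_snd)
  have hks : HasCompactSupport (Function.uncurry fun t s =>
      c.φ (f t * α t (h (t⁻¹ * s))) ((c.u s : H →L[ℂ] H) ξ)) := by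
    refine HasCompactSupport.of_support_subset_isCompact
      (f.hasCompactSupport.isCompact.prod
        (f.hasCompactSupport.isCompact.mul h.hasCompactSupport.isCompact)) ?_
    rintro ⟨t, s⟩ hts
    have hne : f t * α t (h (t⁻¹ * s)) ≠ 0 := fun h0 => hts (by
      simp only [Function.uncurry_apply_pair, h0, map_zero, zero_apply])
    have h1 : t ∈ tsupport f := subset_tsupport _ (left_ne_zero_of_mul hne)
    have h2 : t⁻¹ * s ∈ tsupport h :=
      subset_tsupport _ fun h0 => hne (by rw [h0, map_zero, mul_zero])
    exact ⟨h1, t, h1, t⁻¹ * s, h2, by simp⟩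
  calc c.integralOp (f * h) ξ
      = ∫ s, ∫ t, c.φ (f t * α t (h (t⁻¹ * s))) ((c.u s : H →L[ℂ] H) ξ) ∂μ ∂μ := by
        rw [integralOp_apply]
        congr 1
        funext s
        exact c.φ_apply_eq_integral (CcAlg.continuous_kernel_right f h s)
          (CcAlg.hasCompactSupport_kernel_right f h s) (CcAlg.isWeakIntegral_mul f h s) _
    _ = ∫ t, ∫ s, c.φ (f t * α t (h (t⁻¹ * s))) ((c.u s : H →L[ℂ] H) ξ) ∂μ ∂μ :=
        (integral_integral_swap_of_hasCompactSupport hk hks).symm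
    _ = ∫ t, c.φ (f t) ((c.u t : H →L[ℂ] H) (c.integralOp h ξ)) ∂μ := by
        congr 1
        funext t
        have h1 : ∀ s, c.φ (f t * α t (h (t⁻¹ * s))) ((c.u s : H →L[ℂ] H) ξ) =
            (fun r => (c.φ (f t) * (c.u t : H →L[ℂ] H)) (c.φ (h r) ((c.u r : H →L[ℂ] H) ξ)))
              (t⁻¹ * s) := fun s => by
          conv_lhs => rw [← mul_inv_cancel_left t s, u_mul_apply, map_mul c.φ.toHom]
          simp only [mul_inv_cancel_left, mul_apply_eq_comp,
            φ_action_u_apply]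
        simp only [h1]
        rw [integral_mul_left_eq_self (μ := μ) (fun r => (c.φ (f t) * (c.u t : H →L[ℂ] H))
          (c.φ (h r) ((c.u r : H →L[ℂ] H) ξ))) t⁻¹,
          ContinuousLinearMap.integral_comp_comm _ (c.integrable_integrand h ξ)]
        rfl

theorem integralOp_star (f : CcAlg α μ) : c.integralOp (star f) = star (c.integralOp f) := by
  ext ξ
  refine ext_inner_left ℂ fun η => ?_
  rw [ContinuousLinearMap.star_eq_adjoint, ContinuousLinearMap.adjoint_inner_right,
    integralOp_apply, ← integral_inner (c.integrable_integrand _ ξ), ← inner_conj_symm _ ξ,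
    integralOp_apply, ← integral_inner (c.integrable_integrand f η), ← integral_conj]
  simp only [inner_conj_symm]
  rw [← integral_modularFunction_inv_mul_complex μ
    (f := fun t => ⟪c.φ (f t) ((c.u t : H →L[ℂ] H) η), ξ⟫_ℂ)
    ((c.continuous_integrand f η).inner continuous_const)
    ((c.hasCompactSupport_integrand f η).comp_left (g := fun x => ⟪x, ξ⟫_ℂ) (inner_zero_left _))]
  congr 1
  funext t
  rw [CcAlg.star_apply, map_smul, smul_apply, inner_smul_right,
    φ_action_u_apply, map_star, ContinuousLinearMap.star_eq_adjoint]
  congr 1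
  have h := c.inner_u_left t⁻¹ η ((ContinuousLinearMap.adjoint (c.φ (f t⁻¹))) ξ)
  rw [inv_inv] at h
  rw [← h, ContinuousLinearMap.adjoint_inner_right]

/-- The integrated form `φ × u` of a covariant representation, on `C_c(G, A)`. -/
def integratedForm (μ : Measure G) [μ.IsHaarMeasure] : StarRep (CcAlg α μ) H :=
  have hadd : ∀ f g : CcAlg α μ, c.integralOp (f + g) = c.integralOp f + c.integralOp g :=
    fun f g => by
      ext ξ
      simp only [add_apply, integralOp_apply, CcAlg.add_apply, map_add]
      exact integral_add (c.integrable_integrand f ξ) (c.integrable_integrand g ξ)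
  { toHom :=
      { toFun := c.integralOp
        map_smul' := fun z f => by
          ext ξ
          simp only [integralOp_apply, CcAlg.smul_apply, map_smul, smul_apply]
          exact integral_smul z _
        map_zero' := by
          ext ξ
          simp [integralOp_apply]
        map_add' := hadd
        map_mul' := c.integralOp_mul
        map_star' := c.integralOp_star }
    continuous_toHom := by
      let T : CcAlg α μ →+ (H →L[ℂ] H) := AddMonoidHom.mk' c.integralOp hadd
      refine continuous_of_continuousAt_zero T ?_
      rw [ContinuousAt, map_zero]
      exact squeeze_zero_norm c.norm_integralOp_le
        ((CcAlg.withSeminorms_N.continuous_seminorm c.invSeminorm).tendsto' 0 0 (map_zero _)) }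

theorem integratedForm_apply (f : CcAlg α μ) (ξ : H) :
    c.integratedForm μ f ξ = ∫ t, c.φ (f t) ((c.u t : H →L[ℂ] H) ξ) ∂μ := rfl

theorem integratedForm_tensor {e : G → ℝ} (he : Continuous e) (hes : HasCompactSupport e) (a : A)
    (ξ : H) : c.integratedForm μ (CcAlg.tensor e he hes a) ξ =
      ∫ t, (e t : ℂ) • c.φ a ((c.u t : H →L[ℂ] H) ξ) ∂μ := by
  simp only [integratedForm_apply, CcAlg.tensor_apply, map_smul, smul_apply]

theorem continuous_φ_u (a : A) (ξ : H) : Continuous fun t => c.φ a ((c.u t : H →L[ℂ] H) ξ) :=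
  (c.φ a).continuous.comp (c.continuous_u ξ)

variable {c}

/-- `φ × u` is non-degenerate: `φ(a) ξ` is the limit of `(φ × u)(e ⊗ a) ξ` for bump functions `e`
at `1`. -/
theorem isNondegenerate_extendL1 (h : c.φ.IsNondegenerate) :
    (c.integratedForm μ).extendL1.IsNondegenerate := by
  refine h.eq_top (Submodule.isClosed_topologicalClosure _) fun a ξ => ?_
  refine Metric.mem_closure_iff.2 fun ε hε => ?_
  obtain ⟨e, he, hes, -, -, h1⟩ :=
    exists_bump_norm_integral_smul_sub_le μ (c.continuous_φ_u a ξ) 1 (half_pos hε)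
  rw [← c.integratedForm_tensor he hes, u_one_apply, ← StarRep.extendL1_coe] at h1
  refine ⟨(c.integratedForm μ).extendL1 (CcAlg.tensor e he hes a : CcAlg α μ) ξ,
    Submodule.subset_span ⟨_, ξ, rfl⟩, ?_⟩
  rw [dist_comm, dist_eq_norm]
  exact h1.trans_lt (half_lt_self hε)

/-- The integrated form determines `φ(a) u_s ξ = lim (φ × u)(e ⊗ a) ξ`, with bump functions `e` at
`s`, and thus `φ` and `u`. -/
theorem eq_of_integratedForm_eq {c d : CovariantRep α H} (hc : c.φ.IsNondegenerate)
    (h : ∀ f, c.integratedForm μ f = d.integratedForm μ f) : c = d := by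
  have key : ∀ a s ξ, c.φ a ((c.u s : H →L[ℂ] H) ξ) = d.φ a ((d.u s : H →L[ℂ] H) ξ) := by
    intro a s ξ
    rw [← sub_eq_zero, ← norm_eq_zero]
    refine le_antisymm (le_of_forall_pos_le_add fun ε hε => ?_) (norm_nonneg _)
    obtain ⟨e, he, hes, -, -, h1⟩ := exists_bump_norm_integral_smul_sub_le μ
      (g := fun t => c.φ a ((c.u t : H →L[ℂ] H) ξ) - d.φ a ((d.u t : H →L[ℂ] H) ξ))
      ((c.continuous_φ_u a ξ).sub (d.continuous_φ_u a ξ)) s hε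
    have h2 : ∫ t, (e t : ℂ) • (c.φ a ((c.u t : H →L[ℂ] H) ξ) - d.φ a ((d.u t : H →L[ℂ] H) ξ)) ∂μ
        = 0 := by
      have hi : ∀ c : CovariantRep α H,
          Integrable (fun t => (e t : ℂ) • c.φ a ((c.u t : H →L[ℂ] H) ξ)) μ := fun c =>
        ((Complex.continuous_ofReal.comp he).smul
          (c.continuous_φ_u a ξ)).integrable_of_hasCompactSupport
          ((hes.comp_left (g := fun r : ℝ => (r : ℂ)) Complex.ofReal_zero).smul_right)
      simp only [smul_sub]
      rw [integral_sub (hi c) (hi d), ← c.integratedForm_tensor he hes,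
        ← d.integratedForm_tensor he hes, h, sub_self]
    rwa [h2, zero_sub, norm_neg, ← zero_add ε] at h1
  have hφ : ∀ a, c.φ a = d.φ a := fun a => by
    ext ξ
    simpa only [u_one_apply] using key a 1 ξ
  refine ext hφ fun t ξ => ?_
  -- `φ(A)` is `*`-closed, so a vector killed by it is orthogonal to all `φ(a) η`, hence zero
  rw [← sub_eq_zero]
  set ζ := (c.u t : H →L[ℂ] H) ξ - (d.u t : H →L[ℂ] H) ξ
  have hζ : ∀ a, c.φ a ζ = 0 := fun a => by
    rw [map_sub, key, hφ, sub_self]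
  refine hc.eq_zero_of_inner fun a η => ?_
  rw [← ContinuousLinearMap.adjoint_inner_left, ← ContinuousLinearMap.star_eq_adjoint,
    ← map_star, hζ, inner_zero_left]

end CovariantRep

/-! ### The covariant representation of a representation of `C_c(G, A)` -/

theorem norm_linearCombination_eq_of_inner_eq {ι : Type*} {v w : ι → H}
    (h : ∀ i j, ⟪w i, w j⟫_ℂ = ⟪v i, v j⟫_ℂ) (l : ι →₀ ℂ) :
    ‖Finsupp.linearCombination ℂ w l‖ = ‖Finsupp.linearCombination ℂ v l‖ := by
  have h1 : ⟪Finsupp.linearCombination ℂ w l, Finsupp.linearCombination ℂ w l⟫_ℂ =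
      ⟪Finsupp.linearCombination ℂ v l, Finsupp.linearCombination ℂ v l⟫_ℂ := by
    simp only [Finsupp.linearCombination_apply, Finsupp.sum, sum_inner, inner_sum,
      inner_smul_left, inner_smul_right, h]
  rw [norm_eq_sqrt_re_inner (𝕜 := ℂ), h1, ← norm_eq_sqrt_re_inner]

namespace StarRep

variable (Φ : StarRep (CcAlg α μ) H)

theorem inner_map_map (f g : CcAlg α μ) (ξ η : H) :
    ⟪Φ g η, Φ f ξ⟫_ℂ = ⟪η, Φ (star g * f) ξ⟫_ℂ := by
  rw [map_mul, map_star, mul_apply_eq_comp, ContinuousLinearMap.star_eq_adjoint,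
    ContinuousLinearMap.adjoint_inner_right]

/-- The matrix coefficient `f ↦ ⟪η, Φ(f) ξ⟫`. -/
def coeff (η ξ : H) : CcAlg α μ →ₗ[ℂ] ℂ where
  toFun f := ⟪η, Φ f ξ⟫_ℂ
  map_add' f g := by rw [map_add, add_apply, inner_add_right]
  map_smul' z f := by rw [map_smul, smul_apply, inner_smul_right]; rfl

theorem continuous_apply (ξ : H) : Continuous fun f => Φ f ξ :=
  Φ.continuous_toHom.clm_apply continuous_const

theorem exists_norm_le_N :
    ∃ (p : α.InvSeminorm) (C : ℝ), 0 ≤ C ∧ ∀ f, ‖Φ f‖ ≤ C * CcAlg.N p f :=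
  CcAlg.exists_norm_le_N
    { toFun := Φ, map_add' := map_add Φ.toHom, map_smul' := map_smul Φ.toHom }
    Φ.continuous_toHom

theorem inner_map_mul (f g : CcAlg α μ) (η ξ : H) :
    ⟪η, Φ (f * g) ξ⟫_ℂ =
      ∫ t, ⟪η, Φ (CcAlg.leftMul (f t) (CcAlg.translate t g)) ξ⟫_ℂ ∂μ := by
  obtain ⟨p, C, hC, h⟩ := Φ.exists_norm_le_N
  refine CcAlg.map_mul_eq_integral p (Φ.coeff η ξ) (C := ‖η‖ * ‖ξ‖ * C) (by positivity)
    (fun f => ?_) f g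
  calc ‖⟪η, Φ f ξ⟫_ℂ‖ ≤ ‖η‖ * ‖Φ f ξ‖ := norm_inner_le_norm _ _
    _ ≤ ‖η‖ * (C * CcAlg.N p f * ‖ξ‖) := by
      gcongr
      exact (Φ f).le_of_opNorm_le (h f) ξ
    _ = ‖η‖ * ‖ξ‖ * C * CcAlg.N p f := by ring

theorem inner_map_tensor_mul {e : G → ℝ} (he : Continuous e) (hes : HasCompactSupport e) (a : A)
    (f : CcAlg α μ) (η ξ : H) :
    ⟪η, Φ (CcAlg.tensor e he hes a * f) ξ⟫_ℂ =
      ∫ t, (e t : ℂ) • ⟪η, Φ (CcAlg.leftMul a (CcAlg.translate t f)) ξ⟫_ℂ ∂μ := by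
  rw [inner_map_mul]
  simp only [CcAlg.tensor_apply, CcAlg.smul_leftMul, map_smul, smul_apply, inner_smul_right,
    smul_eq_mul]

/-- The key estimate: `Φ(f) ξ ↦ Φ(a f) ξ` is bounded by a multiple of `p(a)`. It holds because
this map is the weak limit of the operators `Φ(e ⊗ a)`, as `e` runs through an approximate
identity at `1 : G`, and `N_p(e ⊗ a) = p(a)`. -/
theorem norm_linearCombination_leftMul_le {p : α.InvSeminorm} {C : ℝ} (hC : 0 ≤ C)
    (h : ∀ f, ‖Φ f‖ ≤ C * CcAlg.N p f) (a : A) (l : CcAlg α μ × H →₀ ℂ) :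
    ‖Finsupp.linearCombination ℂ (fun x : CcAlg α μ × H => Φ (CcAlg.leftMul a x.1) x.2) l‖ ≤
      C * p.1 a * ‖Finsupp.linearCombination ℂ (fun x : CcAlg α μ × H => Φ x.1 x.2) l‖ := by
  set w := Finsupp.linearCombination ℂ (fun x : CcAlg α μ × H => Φ (CcAlg.leftMul a x.1) x.2) l
    with hw
  set v := Finsupp.linearCombination ℂ (fun x : CcAlg α μ × H => Φ x.1 x.2) l with hv
  have hpa : 0 ≤ p.1 a := apply_nonneg _ _
  have key : ∀ η : H, ‖⟪η, w⟫_ℂ‖ ≤ ‖η‖ * (C * p.1 a * ‖v‖) := fun η => by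
    refine le_of_forall_pos_le_add fun ε hε => ?_
    let k : CcAlg α μ × H → G → ℂ := fun x t =>
      ⟪η, Φ (CcAlg.leftMul a (CcAlg.translate t x.1)) x.2⟫_ℂ
    have hk : ∀ x, Continuous (k x) := fun x =>
      continuous_const.inner
        ((Φ.continuous_apply x.2).comp (CcAlg.continuous_leftMul_translate a x.1))
    let g : G → ℂ := fun t => ∑ x ∈ l.support, l x * k x t
    have hg : Continuous g := continuous_finsetSum _ fun x _ => continuous_const.mul (hk x)
    have hg1 : g 1 = ⟪η, w⟫_ℂ := by
      simp only [g, k, hw, CcAlg.one_translate, Finsupp.linearCombination_apply, Finsupp.sum,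
        inner_sum, inner_smul_right]
    obtain ⟨e, he, hes, he0, he1, hle⟩ := exists_bump_norm_integral_smul_sub_le μ hg 1 hε
    have hT : ‖Φ (CcAlg.tensor e he hes a)‖ ≤ C * p.1 a := by
      refine (h _).trans_eq ?_
      rw [CcAlg.N_tensor p he hes he0, he1, one_mul]
    have hint : ∫ t, (e t : ℂ) • g t ∂μ = ⟪η, Φ (CcAlg.tensor e he hes a) v⟫_ℂ := by
      have hi : ∀ x ∈ l.support, Integrable (fun t => l x * ((e t : ℂ) * k x t)) μ := fun x _ => by
        refine Continuous.integrable_of_hasCompactSupport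
          (continuous_const.mul ((Complex.continuous_ofReal.comp he).mul (hk x))) ?_
        exact HasCompactSupport.mul_left
          (hes.comp_left (g := fun r : ℝ => (r : ℂ)) Complex.ofReal_zero).mul_right
      have h1 : ∀ t, (e t : ℂ) • g t = ∑ x ∈ l.support, l x * ((e t : ℂ) * k x t) := fun t => by
        rw [smul_eq_mul, Finset.mul_sum]
        exact Finset.sum_congr rfl fun x _ => by ring
      simp only [h1]
      rw [integral_finsetSum _ hi]
      simp only [hv, Finsupp.linearCombination_apply, Finsupp.sum, map_sum, map_smul, inner_sum,
        inner_smul_right]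
      refine Finset.sum_congr rfl fun x _ => ?_
      rw [integral_const_mul, ← mul_apply_eq_comp, ← map_mul Φ.toHom, inner_map_tensor_mul]
      rfl
    rw [hint, hg1] at hle
    calc ‖⟪η, w⟫_ℂ‖ ≤ ‖⟪η, Φ (CcAlg.tensor e he hes a) v⟫_ℂ‖ + ε := by
          rw [norm_sub_rev] at hle
          have := norm_sub_norm_le ⟪η, w⟫_ℂ ⟪η, Φ (CcAlg.tensor e he hes a) v⟫_ℂ
          linarith
      _ ≤ ‖η‖ * (C * p.1 a * ‖v‖) + ε := by
          gcongr
          refine (norm_inner_le_norm _ _).trans ?_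
          gcongr
          exact ContinuousLinearMap.le_of_opNorm_le _ hT v
  rcases eq_or_ne w 0 with h0 | h0
  · rw [h0, norm_zero]; positivity
  · have h1 := key w
    rw [inner_self_eq_norm_sq_to_K, norm_pow, RCLike.norm_ofReal, abs_norm, sq] at h1
    exact le_of_mul_le_mul_left h1 (norm_pos_iff.2 h0)

variable {Φ}

theorem IsNondegenerate.eq_of_inner (hΦ : Φ.IsNondegenerate) {x y : H}
    (h : ∀ f ξ, ⟪x, Φ f ξ⟫_ℂ = ⟪y, Φ f ξ⟫_ℂ) : x = y := by
  rw [← sub_eq_zero]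
  exact hΦ.eq_zero_of_inner fun f ξ => by rw [inner_sub_left, h, sub_self]

theorem IsNondegenerate.clm_ext (hΦ : Φ.IsNondegenerate) {S T : H →L[ℂ] H}
    (h : ∀ f ξ, S (Φ f ξ) = T (Φ f ξ)) : S = T :=
  clm_ext_of_dense_span (Φ.isNondegenerate_iff.1 hΦ) fun x => h x.1 x.2

theorem IsNondegenerate.continuous_of_contraction (hΦ : Φ.IsNondegenerate) {U : G → H →L[ℂ] H}
    (hU : ∀ t ξ, ‖U t ξ‖ ≤ ‖ξ‖) (h : ∀ f ξ, Continuous fun t => U t (Φ f ξ)) (ξ : H) :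
    Continuous fun t => U t ξ := by
  have hspan : ∀ ζ ∈ Submodule.span ℂ (Set.range fun x : CcAlg α μ × H => Φ x.1 x.2),
      Continuous fun t => U t ζ := fun ζ hζ => by
    induction hζ using Submodule.span_induction with
    | mem x hx => obtain ⟨⟨f, ξ⟩, rfl⟩ := hx; exact h f ξ
    | zero => simpa using continuous_const
    | add x y _ _ hx hy => simpa only [map_add] using! hx.add hy
    | smul z x _ hx => simpa only [map_smul] using! hx.const_smul z
  have hd := Submodule.dense_iff_topologicalClosure_eq_top.2 (Φ.isNondegenerate_iff.1 hΦ)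
  refine continuous_of_uniform_approx_of_continuous fun V hV => ?_
  obtain ⟨ε, hε, hεV⟩ := Metric.mem_uniformity_dist.1 hV
  obtain ⟨ζ, hζ, hdist⟩ := hd.exists_dist_lt ξ hε
  refine ⟨fun t => U t ζ, hspan ζ hζ, fun t => hεV ?_⟩
  rw [dist_eq_norm, ← map_sub]
  exact (hU t _).trans_lt (by rwa [← dist_eq_norm])

/-- A non-degenerate representation of `C_c(G, A)` extends to the left multipliers of
`C_c(G, A)` given by `A` and `G`. -/
theorem IsNondegenerate.exists_covariantRep (hΦ : Φ.IsNondegenerate) :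
    ∃ c : CovariantRep α H, (∀ a f ξ, c.φ a (Φ f ξ) = Φ (CcAlg.leftMul a f) ξ) ∧
      ∀ s f ξ, (c.u s : H →L[ℂ] H) (Φ f ξ) = Φ (CcAlg.translate s f) ξ := by
  obtain ⟨p, C, hC, hp⟩ := Φ.exists_norm_le_N
  have hd := Φ.isNondegenerate_iff.1 hΦ
  choose T hT hTn using fun a : A => exists_clm_of_norm_linearCombination_le hd
    (Φ.norm_linearCombination_leftMul_le hC hp a)
  choose U hU hUn using fun s : G => exists_clm_of_norm_linearCombination_le hd (C := 1)
    (w := fun x : CcAlg α μ × H => Φ (CcAlg.translate s x.1) x.2) fun l => by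
      rw [one_mul]
      refine (norm_linearCombination_eq_of_inner_eq (fun x y => ?_) l).le
      rw [inner_map_map, inner_map_map, CcAlg.star_translate_mul_translate]
  replace hT : ∀ a f ξ, T a (Φ f ξ) = Φ (CcAlg.leftMul a f) ξ := fun a f ξ => hT a (f, ξ)
  replace hU : ∀ s f ξ, U s (Φ f ξ) = Φ (CcAlg.translate s f) ξ := fun s f ξ => hU s (f, ξ)
  simp only [one_mul] at hUn
  have hTadd : ∀ a b, T (a + b) = T a + T b := fun a b => hΦ.clm_ext fun f ξ => by
    rw [add_apply, hT, hT, hT, CcAlg.add_leftMul, map_add, add_apply]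
  have hU1 : U 1 = 1 := hΦ.clm_ext fun f ξ => by
    rw [hU, CcAlg.one_translate]; rfl
  have hUmul : ∀ s t, U (s * t) = U s * U t := fun s t => hΦ.clm_ext fun f ξ => by
    rw [mul_apply_eq_comp, hU, hU, hU, CcAlg.mul_translate]
  have hUstar : ∀ s, star (U s) = U s⁻¹ := fun s => hΦ.clm_ext fun f ξ => by
    refine hΦ.eq_of_inner fun g η => ?_
    rw [ContinuousLinearMap.star_eq_adjoint, ContinuousLinearMap.adjoint_inner_left, hU, hU,
      inner_map_map, inner_map_map, ← CcAlg.star_translate_mul_translate s (f := g),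
      ← CcAlg.mul_translate, mul_inv_cancel, CcAlg.one_translate]
  let φ : StarRep A H :=
    { toHom :=
        { toFun := T
          map_smul' := fun z a => hΦ.clm_ext fun f ξ => by
            change T (z • a) _ = (z • T a) _
            rw [smul_apply, hT, hT, CcAlg.smul_leftMul, map_smul, smul_apply]
          map_zero' := hΦ.clm_ext fun f ξ => by
            rw [hT, CcAlg.leftMul_zero_left, map_zero]; rfl
          map_add' := hTadd
          map_mul' := fun a b => hΦ.clm_ext fun f ξ => by
            rw [mul_apply_eq_comp, hT, hT, hT, CcAlg.mul_leftMul]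
          map_star' := fun a => hΦ.clm_ext fun f ξ => by
            refine hΦ.eq_of_inner fun g η => ?_
            rw [ContinuousLinearMap.star_eq_adjoint, ContinuousLinearMap.adjoint_inner_left, hT,
              hT, inner_map_map, inner_map_map, CcAlg.star_mul_leftMul] }
      continuous_toHom := by
        let T' : A →+ (H →L[ℂ] H) := AddMonoidHom.mk' T hTadd
        refine continuous_of_continuousAt_zero T' ?_
        rw [ContinuousAt, map_zero]
        refine squeeze_zero_norm (a := fun a => C * p.1 a) (fun a => ?_) ?_
        · exact ContinuousLinearMap.opNorm_le_bound _ (mul_nonneg hC (apply_nonneg _ _)) (hTn a)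
        · exact (continuous_const.mul p.2).tendsto' 0 0 (by simp) }
  let u : G →* unitary (H →L[ℂ] H) :=
    { toFun := fun s => ⟨U s, by
        rw [Unitary.mem_iff, hUstar, ← hUmul, ← hUmul, inv_mul_cancel, mul_inv_cancel]
        exact ⟨hU1, hU1⟩⟩
      map_one' := Subtype.ext hU1
      map_mul' := fun s t => Subtype.ext (hUmul s t) }
  refine ⟨⟨φ, u, hΦ.continuous_of_contraction hUn fun f ξ => ?_, fun t a => ?_⟩, hT, hU⟩
  · change Continuous fun t => U t (Φ f ξ)
    simp only [hU]
    exact (Φ.continuous_apply ξ).comp (CcAlg.continuous_translate f)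
  · change T (α t a) = U t * T a * star (U t)
    rw [hUstar]
    refine hΦ.clm_ext fun f ξ => ?_
    rw [mul_apply_eq_comp, mul_apply_eq_comp, hU, hT, hT, hU, CcAlg.translate_leftMul,
      ← CcAlg.mul_translate, mul_inv_cancel, CcAlg.one_translate]

/-- On vectors `Φ(g) ξ`, the integrated form is `∫ Φ(f(t) (t · g)) ξ dt = Φ(f × g) ξ`. -/
theorem IsNondegenerate.integratedForm_eq (hΦ : Φ.IsNondegenerate) {c : CovariantRep α H}
    (hφ : ∀ a f ξ, c.φ a (Φ f ξ) = Φ (CcAlg.leftMul a f) ξ)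
    (hu : ∀ s f ξ, (c.u s : H →L[ℂ] H) (Φ f ξ) = Φ (CcAlg.translate s f) ξ) (f : CcAlg α μ) :
    c.integratedForm μ f = Φ f :=
  hΦ.clm_ext fun g ξ => ext_inner_left ℂ fun η => by
    rw [CovariantRep.integratedForm_apply, ← integral_inner (c.integrable_integrand f _),
      ← mul_apply_eq_comp, ← map_mul Φ.toHom, inner_map_mul]
    simp only [hφ, hu]

end StarRep

/-- If `η` is orthogonal to all `φ(a) ξ`, then it is orthogonal to all `∫ φ(f(t)) u_t ξ dt`. -/
theorem CovariantRep.isNondegenerate_of_integratedForm {c : CovariantRep α H}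
    (h : (c.integratedForm μ).IsNondegenerate) : c.φ.IsNondegenerate := by
  rw [StarRep.IsNondegenerate, Submodule.topologicalClosure_eq_top_iff, Submodule.eq_bot_iff]
  intro η hη
  refine h.eq_zero_of_inner fun f ξ => ?_
  rw [CovariantRep.integratedForm_apply, ← integral_inner (c.integrable_integrand f ξ)]
  have h0 : ∀ t, ⟪η, c.φ (f t) ((c.u t : H →L[ℂ] H) ξ)⟫_ℂ = 0 := fun t =>
    (Submodule.mem_orthogonal' _ _).1 hη _ (Submodule.subset_span ⟨_, _, rfl⟩)
  simp [h0]

end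

theorem proposition3p13
    {G : Type*} [Group G] [TopologicalSpace G] [IsTopologicalGroup G] [LocallyCompactSpace G]
    [T2Space G] [MeasurableSpace G] [BorelSpace G]
    (μ : MeasureTheory.Measure G) [μ.IsHaarMeasure]
    {A : Type*} [NonUnitalRing A] [StarRing A] [Module ℂ A] [IsScalarTower ℂ A A]
    [SMulCommClass ℂ A A] [StarModule ℂ A] [UniformSpace A] [LocallyCStarAlgebra A]
    (α : ContinuousAction G A) (hα : ContinuousAction.IsInverseLimitAction.{v, w} α)
    (H : Type*) [NormedAddCommGroup H] [InnerProductSpace ℂ H] [CompleteSpace H] :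
    ∃ F : {c : CovariantRep α H // c.φ.IsNondegenerate} →
        {Φ : StarRep (L1Alg α μ) H // Φ.IsNondegenerate},
      (∀ (c : {c : CovariantRep α H // c.φ.IsNondegenerate}) (f : CcAlg α μ) (ξ : H),
        (F c).1 (f : L1Alg α μ) ξ = ∫ t, c.1.φ (f t) ((c.1.u t : H →L[ℂ] H) ξ) ∂μ) ∧
      Function.Bijective F := by
  refine ⟨fun c => ⟨(c.1.integratedForm μ).extendL1, CovariantRep.isNondegenerate_extendL1 c.2⟩,
    fun c f ξ => ?_, fun c d hcd => ?_, fun Φ => ?_⟩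
  · rw [StarRep.extendL1_coe, CovariantRep.integratedForm_apply]
  · refine Subtype.ext (CovariantRep.eq_of_integratedForm_eq (μ := μ) c.2 fun f => ?_)
    have h : (c.1.integratedForm μ).extendL1 = (d.1.integratedForm μ).extendL1 :=
      congrArg Subtype.val hcd
    rw [← StarRep.extendL1_coe, h, StarRep.extendL1_coe]
  · have hΦ := Φ.2.restrictCc
    obtain ⟨c, hφ, hu⟩ := hΦ.exists_covariantRep
    have hc : c.integratedForm μ = Φ.1.restrictCc := StarRep.ext (hΦ.integratedForm_eq hφ hu)
    refine ⟨⟨c, CovariantRep.isNondegenerate_of_integratedForm (μ := μ) (hc ▸ hΦ)⟩,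
      Subtype.ext (StarRep.ext_of_coe fun f => ?_)⟩
    rw [StarRep.extendL1_coe, hc, StarRep.restrictCc_apply]
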